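/- Let $d\ge 1$, let $\mathcal D\subset\mathbb R^d$ be a bounded domain (non-empty, open, connected), and let $T>0$. Let $f$ be a continuous function on $\mathbb R_+\times\partial\mathcal D$ and let $f_0$ be a function on $\overline{\mathcal D}$, continuous on $\mathcal D$, with $f(0,x)=f_0(x)$ for $x\in\partial\mathcal D$. By a solution we mean a function $u$ on $[0,T]\times\overline{\mathcal D}$ that is continuous on $[0,T]\times\overline{\mathcal D}$, is of class $\mathcal C^{1,2}$ on $[0,T]\times\mathcal D$ (that is, $\partial_t u$, $\partial_x u$ and $\partial_x^2u$ exist and are jointly continuous there, time derivatives being one-sided at $t=0$ and $t=T$), and satisfies $$\partial_t u=\Delta_x u\ \text{ on }[0,T]\times\mathcal D,\qquad u=f\ \text{ on }[0,T]\times\partial\mathcal D,\qquad u(0,\cdot)=f_0\ \text{ on }\mathcal D .$$ **Random walk on heat balls.** Let $(U_n)_{n\ge1}$ be i.i.d. uniform on $[0,1]^{\lfloor d/2\rfloor+1}$, with $\Pi^U_n$ the product of the coordinates of $U_n$, let $(G_n)_{n\ge1}$ be i.i.d. standard Gaussian, let $(V_n)_{n\ge1}$ be i.i.d. uniform on the unit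 sphere of $\mathbb R^d$ centred at the origin, and let the three sequences be independent; they are defined on an arbitrary probability space. Put $$\alpha(s,y)=\min\Big(s,\tfrac{e}{2d}\,\delta(y,\partial\mathcal D)^2\Big),\quad \psi_d(s)=\sqrt{s\log(s^{-d/2})},\quad R_n=(\Pi^U_n)^{2/d}\exp\Big\{-\Big(1-\tfrac2d\lfloor\tfrac d2\rfloor\Big)G_n^2\Big\},$$ where $\delta(y,\partial\mathcal D)$ is the Euclidean distance from $y$ to $\partial\mathcal D$. For $(t,x)\in[0,T]\times\overline{\mathcal D}$ set $(T_0,X_0)=(t,x)$ and, for $n\ge0$, $$T_{n+1}=T_n-\alpha(T_n,X_n)R_{n+1},\qquad X_{n+1}=X_n+2\sqrt{\alpha(T_n,X_n)}\;\psi_d(R_{n+1})\,V_{n+1}.$$ **Claim.** Let $u$ be a solution. Then $u$ is the unique solution: every solution $v$ equals $u$ on $[0,T]\times\overline{\mathcal D}$. Moreover, for every $(t,x)\in[0,T]\times\overline{\mathcal D}$ the sequence $(T_n,X_n)$ started at $(t,x)$ converges almost surely; its limit $(T_\infty,X_\infty)$ lies almost surely in $\{0\}\times\overline{\mathcal D}\,\cup\,]0,t]\times\partial\mathcal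 D$, and, if $x\in\mathcal D$, almost surely in $\{0\}\times\overline{\mathcal D}\,\cup\,]0,t[\times\partial\mathcal D$; the random variables $f(T_\infty,X_\infty)1_{\{X_\infty\in\partial\mathcal D\}}$ and $f_0(X_\infty)1_{\{X_\infty\notin\partial\mathcal D\}}$ are integrable, and $$u(t,x)=\mathbb E_{(t,x)}\big[f(T_\infty,X_\infty)1_{\{X_\infty\in\partial\mathcal D\}}\big]+\mathbb E_{(t,x)}\big[f_0(X_\infty)1_{\{X_\infty\notin\partial\mathcal D\}}\big].$$ -/

import Mathlib

open Set Filter Topology MeasureTheory ProbabilityTheory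

namespace HeatWalk

noncomputable section

/-- The Euclidean space `ℝ^d`. -/
abbrev E (d : ℕ) : Type := EuclideanSpace ℝ (Fin d)

/-- `u` is of class `C^{1,2}` on `[0,T] × D` (`D` open): `∂_t u`, `∂_x u`, `∂²_x u` exist and are
jointly continuous there. The time derivative is one-sided at `t = 0` and `t = T`. -/
structure IsC12 {d : ℕ} (T : ℝ) (D : Set (E d)) (u : ℝ → E d → ℝ) : Prop where
  continuousOn : ContinuousOn (fun p : ℝ × E d => u p.1 p.2) (Icc 0 T ×ˢ D)
  differentiable_time : ∀ t ∈ Icc 0 T, ∀ x ∈ D,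
    DifferentiableWithinAt ℝ (fun s => u s x) (Icc 0 T) t
  continuousOn_deriv_time :
    ContinuousOn (fun p : ℝ × E d => derivWithin (fun s => u s p.2) (Icc 0 T) p.1)
      (Icc 0 T ×ˢ D)
  contDiffOn_space : ∀ t ∈ Icc 0 T, ContDiffOn ℝ 2 (u t) D
  continuousOn_fderiv :
    ContinuousOn (fun p : ℝ × E d => fderiv ℝ (u p.1) p.2) (Icc 0 T ×ˢ D)
  continuousOn_fderiv_two :
    ContinuousOn (fun p : ℝ × E d => iteratedFDeriv ℝ 2 (u p.1) p.2) (Icc 0 T ×ˢ D)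

/-- `u` is a classical solution on `[0,T]` of the initial-boundary value problem
`∂_t u = Δ_x u` in `D`, `u = f` on `∂D`, `u(0,·) = f₀` in `D`: it is `C^{1,2}` on `[0,T] × D` and
continuous on `[0,T] × closure D`. -/
structure IsSolution {d : ℕ} (T : ℝ) (D : Set (E d)) (f : ℝ → E d → ℝ) (f₀ : E d → ℝ)
    (u : ℝ → E d → ℝ) : Prop where
  isC12 : IsC12 T D u
  continuousOn_closure : ContinuousOn (fun p : ℝ × E d => u p.1 p.2) (Icc 0 T ×ˢ closure D)
  heat_eq : ∀ t ∈ Icc 0 T, ∀ x ∈ D,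
    derivWithin (fun s => u s x) (Icc 0 T) t = Laplacian.laplacian (u t) x
  boundary : ∀ t ∈ Icc 0 T, ∀ x ∈ frontier D, u t x = f t x
  initial : ∀ x ∈ D, u 0 x = f₀ x

/-- The uniform probability measure on the unit sphere of `ℝ^d`: normalized surface measure. -/
def sphereUniform (d : ℕ) : Measure (Metric.sphere (0 : E d) 1) :=
  ((volume : Measure (E d)).toSphere univ)⁻¹ • (volume : Measure (E d)).toSphere

/-- The driving noise of the walk. Index `n` here is the index `n + 1` of the recursion:
`U n` is uniform on `[0,1]^{⌊d/2⌋+1}`, `G n` is standard Gaussian, `V n` is uniform on the unit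
sphere of `ℝ^d`; each sequence is independent, and the three sequences are
(mutually) independent. -/
structure IsNoise {d : ℕ} {Ω : Type*} [MeasurableSpace Ω] (P : Measure Ω)
    (U : ℕ → Ω → (Fin (d / 2 + 1) → ℝ)) (G : ℕ → Ω → ℝ)
    (V : ℕ → Ω → Metric.sphere (0 : E d) 1) : Prop where
  measurable_U : ∀ n, Measurable (U n)
  measurable_G : ∀ n, Measurable (G n)
  measurable_V : ∀ n, Measurable (V n)
  law_U : ∀ n, P.map (U n) = volume.restrict (Icc 0 1)
  law_G : ∀ n, P.map (G n) = gaussianReal 0 1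
  law_V : ∀ n, P.map (V n) = sphereUniform d
  indep_U : iIndepFun U P
  indep_G : iIndepFun G P
  indep_V : iIndepFun V P
  indep_U_GV : IndepFun (fun ω n => U n ω) (fun ω => ((fun n => G n ω), (fun n => V n ω))) P
  indep_G_V : IndepFun (fun ω n => G n ω) (fun ω n => V n ω) P

/-- `α(s,y) = min(s, e/(2d) · δ(y,∂D)²)`. -/
def alpha {d : ℕ} (D : Set (E d)) (s : ℝ) (y : E d) : ℝ :=
  min s (Real.exp 1 / (2 * d) * Metric.infDist y (frontier D) ^ 2)

/-- `ψ_d(s) = √(s log(s^{-d/2}))`. -/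
def psi (d : ℕ) (s : ℝ) : ℝ := Real.sqrt (s * Real.log (s ^ (-(d : ℝ) / 2)))

/-- `R = (∏ᵢ Uᵢ)^{2/d} exp(-(1 - (2/d)⌊d/2⌋) G²)`; here `d / 2 : ℕ` is `⌊d/2⌋`. -/
def radius (d : ℕ) (U : Fin (d / 2 + 1) → ℝ) (G : ℝ) : ℝ :=
  (∏ i, U i) ^ (2 / (d : ℝ)) * Real.exp (-(1 - 2 / (d : ℝ) * ((d / 2 : ℕ) : ℝ)) * G ^ 2)

/-- The random walk on heat balls `(T_n, X_n)` started at `(t,x)`. -/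
def walk {d : ℕ} (D : Set (E d)) {Ω : Type*} (U : ℕ → Ω → (Fin (d / 2 + 1) → ℝ))
    (G : ℕ → Ω → ℝ) (V : ℕ → Ω → Metric.sphere (0 : E d) 1) (t : ℝ) (x : E d) :
    ℕ → Ω → ℝ × E d
  | 0, _ => (t, x)
  | n + 1, ω =>
    let M := walk D U G V t x n ω
    let R := radius d (U n ω) (G n ω)
    (M.1 - alpha D M.1 M.2 * R,
      M.2 + (2 * Real.sqrt (alpha D M.1 M.2) * psi d R) • (V n ω : E d))

/-- `(T_∞, X_∞) = lim (T_n, X_n)`, with an arbitrary value where the limit does not exist. -/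
def walkLimit {d : ℕ} (D : Set (E d)) {Ω : Type*} (U : ℕ → Ω → (Fin (d / 2 + 1) → ℝ))
    (G : ℕ → Ω → ℝ) (V : ℕ → Ω → Metric.sphere (0 : E d) 1) (t : ℝ) (x : E d)
    (ω : Ω) : ℝ × E d :=
  limUnder atTop (fun n => walk D U G V t x n ω)

end

end HeatWalk

/-! The kernel K(s,r) = s^{-d/2} exp(-r²/(4s)) equals 1 on 0 < s ≤ 1 exactly when r = 2ψ_d(s), so
one step of the walk lands on the boundary of a heat ball with top (t,x), rescaled by α(t,x). The
factor e/(2d) in α makes the widest section of this ball fit in the distance to ∂D, and α ≤ t keeps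
times nonnegative. The heart of the matter is that the law of the step is the very measure for which
solutions of the heat equation have the mean value property. Then u(T_n,X_n) has constant
expectation (`IsSolution.integral_walk`), and n tends to infinity.

Mean value property. Let m(s,r) be the spherical means of u around x at time t - as, and let S(s) be
the integral of r^{d-1} (K-1)⁺ m over r. Since K-1 vanishes at the edge of the section, Green's
formula leaves only the flux of K, so that S'(s) = -w(s) m(s, 2ψ_d(s)) with w(s) = (2ψ_d(s))^d/(2s)
(`IsRadialCaloric.hasDerivAt_sectionMass`). As S vanishes at s = 1 and the sections shrink to r = 0
when s → 0, the integral of w(s) m(s, 2ψ_d(s)) is m(0,0) times that of w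
(`IsRadialCaloric.integral_heatWeight_mul`). The flux identity for spherical means is the divergence
theorem on balls, proved by testing against radial fields (`sphere_flux_eq`).

Law of R. Under s = e^{-z} the weight w becomes a multiple of the Gamma density of shape d/2+1 and
rate d/2. On the other side -log R is a sum of ⌊d/2⌋+1 exponentials of rate d/2 and, for odd d, of
G²/d, a Gamma variable of shape 1/2 and the same rate. The proof compares moments on [0,1] and
concludes by polynomial approximation (`integral_radius_comp_mul`).

Limit. T_n is nonincreasing and X_n is a bounded martingale, so both converge. By independence E[T_n
- T_{n+1}] = E[α(T_n,X_n)] E[R]; the left side tends to 0 and E[R] > 0, hence α vanishes at the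
limit point, which means T_∞ = 0 or X_∞ ∈ ∂D. Dominated convergence gives the formula. Its right
side does not involve u, whence uniqueness. -/

/-! ### The heat kernel profile and its unit level set. -/

namespace HeatWalk

/-- The radial profile `s^{-d/2} e^{-r²/(4s)}` of the (unnormalized) heat kernel. -/
noncomputable def heatProfile (d : ℕ) (s r : ℝ) : ℝ :=
  s ^ (-(d : ℝ) / 2) * Real.exp (-r ^ 2 / (4 * s))

/-- The time derivative of `heatProfile`. -/
noncomputable def heatProfileTime (d : ℕ) (s r : ℝ) : ℝ :=
  heatProfile d s r * (-(d : ℝ) / (2 * s) + r ^ 2 / (4 * s ^ 2))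

/-- The radius at time `s` of the section of the unit heat ball. -/
noncomputable def ballRadius (d : ℕ) (s : ℝ) : ℝ := 2 * psi d s

lemma log_rpow_dim {s : ℝ} (d : ℕ) (hs : 0 ≤ s) :
    s * Real.log (s ^ (-(d : ℝ) / 2)) = -(d / 2 : ℝ) * (s * Real.log s) := by
  rcases hs.eq_or_lt with rfl | h
  · simp
  · rw [Real.log_rpow h]; ring

lemma psi_eq {s : ℝ} (d : ℕ) (hs : 0 ≤ s) :
    psi d s = Real.sqrt (-(d / 2 : ℝ) * (s * Real.log s)) := by
  rw [psi, log_rpow_dim d hs]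

lemma continuousOn_psi (d : ℕ) : ContinuousOn (psi d) (Ici 0) := by
  have : Continuous fun s : ℝ => Real.sqrt (-(d / 2 : ℝ) * (s * Real.log s)) :=
    (continuous_const.mul Real.continuous_mul_log).sqrt
  exact this.continuousOn.congr fun s hs => psi_eq d hs

lemma continuousOn_ballRadius (d : ℕ) : ContinuousOn (ballRadius d) (Ici 0) :=
  continuousOn_const.mul (continuousOn_psi d)

lemma psi_nonneg (d : ℕ) (s : ℝ) : 0 ≤ psi d s := Real.sqrt_nonneg _

lemma ballRadius_nonneg (d : ℕ) (s : ℝ) : 0 ≤ ballRadius d s :=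
  mul_nonneg zero_le_two (psi_nonneg d s)

lemma psi_zero (d : ℕ) : psi d 0 = 0 := by simp [psi]

/-- This is 1 + y ≤ e^y at y = -log s - 1. The bound is attained at s = 1/e and is the source of the
constant e in `alpha`. -/
lemma neg_mul_log_le {s : ℝ} (hs : 0 ≤ s) : -(s * Real.log s) ≤ Real.exp (-1) := by
  rcases hs.eq_or_lt with rfl | h
  · simpa using (Real.exp_pos (-1)).le
  have h1 := Real.add_one_le_exp (-Real.log s - 1)
  have h2 : Real.exp (-Real.log s - 1) = Real.exp (-1) / s := by
    rw [Real.exp_sub, Real.exp_neg, Real.exp_log h, Real.exp_neg]; field_simp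
  rw [h2, le_div_iff₀ h] at h1
  linarith

lemma psi_sq {s : ℝ} (d : ℕ) (hs : s ∈ Icc (0 : ℝ) 1) :
    psi d s ^ 2 = (d / 2 : ℝ) * (-(s * Real.log s)) := by
  rw [psi_eq d hs.1, Real.sq_sqrt]
  · ring
  · have := mul_nonneg hs.1 (neg_nonneg.2 (Real.log_nonpos hs.1 hs.2))
    have : (0 : ℝ) ≤ d / 2 * (s * -Real.log s) := by positivity
    linarith

lemma psi_sq_le {s : ℝ} (d : ℕ) (hs : s ∈ Icc (0 : ℝ) 1) :
    psi d s ^ 2 ≤ d / (2 * Real.exp 1) := by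
  rw [psi_sq d hs]
  calc (d / 2 : ℝ) * (-(s * Real.log s)) ≤ d / 2 * Real.exp (-1) := by
        gcongr; exact neg_mul_log_le hs.1
    _ = _ := by rw [Real.exp_neg]; field_simp

/-- Since s^{-d/2} = exp(ρ²/(4s)) with ρ = `ballRadius d s`, comparing the kernel with 1 amounts to
comparing r with ρ. -/
lemma heatProfile_eq_exp (d : ℕ) {s : ℝ} (hs : s ∈ Ioc (0 : ℝ) 1) (r : ℝ) :
    heatProfile d s r = Real.exp ((ballRadius d s ^ 2 - r ^ 2) / (4 * s)) := by
  have hs0 : s ≠ 0 := hs.1.ne'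
  rw [heatProfile, Real.rpow_def_of_pos hs.1, ← Real.exp_add, ballRadius, mul_pow,
    psi_sq d ⟨hs.1.le, hs.2⟩]
  congr 1; field_simp; ring

lemma heatProfile_ballRadius (d : ℕ) {s : ℝ} (hs : s ∈ Ioc (0 : ℝ) 1) :
    heatProfile d s (ballRadius d s) = 1 := by
  rw [heatProfile_eq_exp d hs]; simp

lemma one_lt_heatProfile (d : ℕ) {s r : ℝ} (hs : s ∈ Ioc (0 : ℝ) 1) (hr : 0 ≤ r)
    (h : r < ballRadius d s) : 1 < heatProfile d s r := by
  rw [heatProfile_eq_exp d hs, Real.one_lt_exp_iff]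
  have := hs.1
  have : r ^ 2 < ballRadius d s ^ 2 := by gcongr
  exact div_pos (by linarith) (by linarith)

lemma heatProfile_lt_one (d : ℕ) {s r : ℝ} (hs : s ∈ Ioc (0 : ℝ) 1)
    (h : ballRadius d s < r) : heatProfile d s r < 1 := by
  rw [heatProfile_eq_exp d hs, Real.exp_lt_one_iff]
  have := hs.1
  have : ballRadius d s ^ 2 < r ^ 2 := by have := ballRadius_nonneg d s; gcongr
  exact div_neg_of_neg_of_pos (by linarith) (by linarith)

lemma hasDerivAt_heatProfile_time (d : ℕ) {s : ℝ} (hs : 0 < s) (r : ℝ) :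
    HasDerivAt (fun s => heatProfile d s r) (heatProfileTime d s r) s := by
  have h1 : HasDerivAt (fun s : ℝ => s ^ (-(d : ℝ) / 2))
      (-(d : ℝ) / 2 * s ^ (-(d : ℝ) / 2 - 1)) s := Real.hasDerivAt_rpow_const (Or.inl hs.ne')
  have h2 : HasDerivAt (fun s : ℝ => -r ^ 2 / (4 * s)) (r ^ 2 / (4 * s ^ 2)) s := by
    have := ((hasDerivAt_inv hs.ne').const_mul (-r ^ 2 / 4))
    refine (this.congr_deriv (by field_simp)).congr_of_eventuallyEq (Eventually.of_forall ?_)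
    intro x; simp only []; rw [← div_eq_mul_inv, div_div]
  refine (h1.mul h2.exp).congr_deriv ?_
  rw [heatProfileTime, heatProfile, Real.rpow_sub_one hs.ne']
  field_simp

lemma hasDerivAt_heatProfile_space (d : ℕ) (s r : ℝ) :
    HasDerivAt (fun r => heatProfile d s r) (-(r / (2 * s)) * heatProfile d s r) r := by
  have h2 : HasDerivAt (fun r : ℝ => -r ^ 2 / (4 * s)) (-(r / (2 * s))) r := by
    refine (((hasDerivAt_pow 2 r).neg).div_const (4 * s)).congr_deriv ?_
    by_cases hs : s = 0
    · simp [hs]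
    field_simp; ring
  refine (h2.exp.const_mul _).congr_deriv ?_
  rw [heatProfile]; ring

lemma continuousOn_heatProfile (d : ℕ) :
    ContinuousOn (fun p : ℝ × ℝ => heatProfile d p.1 p.2) (Ioi 0 ×ˢ univ) := by
  unfold heatProfile
  refine ContinuousOn.mul ?_ ?_
  · exact continuousOn_fst.rpow_const fun p hp => Or.inl hp.1.ne'
  · refine Real.continuous_exp.comp_continuousOn (ContinuousOn.div (by fun_prop) (by fun_prop) ?_)
    intro p hp; have : 0 < p.1 := hp.1
    positivity

lemma continuousOn_heatProfileTime (d : ℕ) :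
    ContinuousOn (fun p : ℝ × ℝ => heatProfileTime d p.1 p.2) (Ioi 0 ×ˢ univ) := by
  refine (continuousOn_heatProfile d).mul (ContinuousOn.add ?_ ?_)
  all_goals
    refine ContinuousOn.div (by fun_prop) (by fun_prop) ?_
    intro p hp; have : 0 < p.1 := hp.1
    positivity

end HeatWalk

/-! ### Green's formula on the sections of a heat ball. -/

namespace HeatWalk

/-- `m` behaves like the spherical means of a solution of the backward heat equation on
`[0,1] × [0,r₀]`, with source `h` and radial derivative `q`. -/
structure IsRadialCaloric (d : ℕ) (r₀ : ℝ) (m h q : ℝ → ℝ → ℝ) : Prop where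
  cont : ContinuousOn (fun p : ℝ × ℝ => m p.1 p.2) (Icc 0 1 ×ˢ Icc 0 r₀)
  cont_source : ContinuousOn (fun p : ℝ × ℝ => h p.1 p.2) (Icc 0 1 ×ˢ Icc 0 r₀)
  deriv_time : ∀ s ∈ Ioo (0 : ℝ) 1, ∀ r ∈ Icc 0 r₀, HasDerivAt (fun s => m s r) (-h s r) s
  deriv_space : ∀ s ∈ Ioo (0 : ℝ) 1, ∀ r ∈ Ioo 0 r₀, HasDerivAt (m s) (q s r) r
  flux : ∀ s ∈ Ioo (0 : ℝ) 1, ∀ r ∈ Ioo 0 r₀,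
    r ^ (d - 1) * q s r = ∫ τ in (0 : ℝ)..r, τ ^ (d - 1) * h s τ

variable {d : ℕ} {r₀ : ℝ} {m h q : ℝ → ℝ → ℝ}

lemma IsRadialCaloric.cont_slice (H : IsRadialCaloric d r₀ m h q) {s : ℝ} (hs : s ∈ Icc (0 : ℝ) 1) :
    ContinuousOn (m s) (Icc 0 r₀) :=
  H.cont.comp (f := fun r => (s, r)) (by fun_prop) fun _ hr => ⟨hs, hr⟩

lemma IsRadialCaloric.cont_source_slice (H : IsRadialCaloric d r₀ m h q) {s : ℝ}
    (hs : s ∈ Icc (0 : ℝ) 1) : ContinuousOn (h s) (Icc 0 r₀) :=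
  H.cont_source.comp (f := fun r => (s, r)) (by fun_prop) fun _ hr => ⟨hs, hr⟩

/-- Green's formula on a section of the heat ball. -/
lemma IsRadialCaloric.integral_section (hd : 0 < d) (H : IsRadialCaloric d r₀ m h q)
    {s : ℝ} (hs : s ∈ Ioo (0 : ℝ) 1) (hr₀ : ballRadius d s ≤ r₀) :
    ∫ r in (0 : ℝ)..ballRadius d s, r ^ (d - 1) *
        (heatProfileTime d s r * m s r - (heatProfile d s r - 1) * h s r) =
      -(ballRadius d s ^ d / (2 * s) * m s (ballRadius d s)) := by
  have hs' : s ∈ Icc (0 : ℝ) 1 := Ioo_subset_Icc_self hs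
  have hsub : Icc 0 (ballRadius d s) ⊆ Icc 0 r₀ := Icc_subset_Icc_right hr₀
  have hρ := ballRadius_nonneg d s
  have cm := (H.cont_slice hs').mono hsub
  have ch := (H.cont_source_slice hs').mono hsub
  have cK : Continuous (heatProfile d s) := continuous_iff_continuousAt.2 fun r =>
    (hasDerivAt_heatProfile_space d s r).continuousAt
  have cKt : Continuous (heatProfileTime d s) := by
    unfold heatProfileTime; fun_prop
  have cth : ContinuousOn (fun τ => τ ^ (d - 1) * h s τ) (Icc 0 (ballRadius d s)) :=
    (by fun_prop : Continuous fun τ : ℝ => τ ^ (d - 1)).continuousOn.mul ch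
  have ith : IntervalIntegrable (fun τ => τ ^ (d - 1) * h s τ) volume 0 (ballRadius d s) :=
    cth.intervalIntegrable_of_Icc hρ
  have cI : ContinuousOn (fun r => ∫ τ in (0 : ℝ)..r, τ ^ (d - 1) * h s τ)
      (Icc 0 (ballRadius d s)) := by
    have := intervalIntegral.continuousOn_primitive_interval' ith left_mem_uIcc
    rwa [uIcc_of_le hρ] at this
  -- The antiderivative is the Green expression r^{d-1} (∂_r K · m - (K-1) · ∂_r m). The term
  -- r^{d-1} ∂_r m is written as the integral of the source, which is continuous up to both
  -- endpoints, whereas q is controlled only in the open interval. The kernel equation ∂_r(r^{d-1}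
  -- ∂_r K) = r^{d-1} ∂_s K makes the derivatives match.
  have key := intervalIntegral.integral_eq_sub_of_hasDerivAt_of_le hρ
    (f := fun r => -(r ^ d / (2 * s)) * heatProfile d s r * m s r -
      (heatProfile d s r - 1) * ∫ τ in (0 : ℝ)..r, τ ^ (d - 1) * h s τ)
    (f' := fun r => r ^ (d - 1) *
        (heatProfileTime d s r * m s r - (heatProfile d s r - 1) * h s r)) ?_ ?_ ?_
  · rw [key, heatProfile_ballRadius d ⟨hs.1, hs.2.le⟩]
    simp [hd.ne']
  · exact (((by fun_prop : Continuous fun r => -(r ^ d / (2 * s)) * heatProfile d s r).continuousOn.mul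
      cm).sub ((cK.sub continuous_const).continuousOn.mul cI))
  · intro r hr
    have hr' : r ∈ Ioo 0 r₀ := ⟨hr.1, hr.2.trans_le hr₀⟩
    have d1 := hasDerivAt_heatProfile_space d s r
    have d2 := H.deriv_space s hs r hr'
    have d3 : HasDerivAt (fun r => ∫ τ in (0 : ℝ)..r, τ ^ (d - 1) * h s τ)
        (r ^ (d - 1) * h s r) r := by
      refine intervalIntegral.integral_hasDerivAt_right
        (ith.mono_set (by rw [uIcc_of_le hρ, uIcc_of_le hr.1.le]; exact Icc_subset_Icc_right hr.2.le))
        ?_ (cth.continuousAt (Icc_mem_nhds hr.1 hr.2))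
      exact ContinuousOn.stronglyMeasurableAtFilter isOpen_Ioo (cth.mono Ioo_subset_Icc_self) r hr
    have d4 : HasDerivAt (fun r : ℝ => -(r ^ d / (2 * s))) (-(d * r ^ (d - 1) / (2 * s))) r :=
      ((hasDerivAt_pow d r).div_const _).neg
    refine (((d4.mul d1).mul d2).sub ((d1.sub_const 1).mul d3)).congr_deriv ?_
    simp only [Pi.mul_apply]
    rw [← H.flux s hs r hr', heatProfileTime, ← pow_sub_one_mul hd.ne' r]
    have := hs.1.ne'
    field_simp
    ring
  · refine ContinuousOn.intervalIntegrable_of_Icc hρ ?_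
    exact (by fun_prop : Continuous fun τ : ℝ => τ ^ (d - 1)).continuousOn.mul
      ((cKt.continuousOn.mul cm).sub ((cK.sub continuous_const).continuousOn.mul ch))

/-- The mass of `m` in a section of the heat ball, weighted by the truncated heat kernel. -/
noncomputable def sectionMass (d : ℕ) (r₀ : ℝ) (m : ℝ → ℝ → ℝ) (s : ℝ) : ℝ :=
  ∫ r in (0 : ℝ)..r₀, r ^ (d - 1) * (max (heatProfile d s r - 1) 0 * m s r)

/-- The moving edge of the section contributes nothing because K - 1 vanishes there. Truncating by a
positive part keeps the domain of integration fixed, so the derivative passes under the integral and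
Green's formula evaluates the result. -/
lemma IsRadialCaloric.hasDerivAt_sectionMass (hd : 0 < d) (H : IsRadialCaloric d r₀ m h q)
    (hr₀ : ∀ s ∈ Icc (0 : ℝ) 1, ballRadius d s ≤ r₀) {s : ℝ} (hs : s ∈ Ioo (0 : ℝ) 1) :
    HasDerivAt (sectionMass d r₀ m) (-(ballRadius d s ^ d / (2 * s) * m s (ballRadius d s))) s := by
  have hr0 : 0 ≤ r₀ := (ballRadius_nonneg d s).trans (hr₀ s (Ioo_subset_Icc_self hs))
  obtain ⟨a, ha0, has⟩ := exists_between hs.1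
  obtain ⟨b, hsb, hb1⟩ := exists_between hs.2
  have hab : Icc a b ⊆ Icc 0 1 := Icc_subset_Icc ha0.le hb1.le
  have hab' : Icc a b ⊆ Ioo 0 1 := fun x hx => ⟨ha0.trans_le hx.1, hx.2.trans_lt hb1⟩
  have hcpt : IsCompact (Icc a b ×ˢ Icc (0 : ℝ) r₀) := isCompact_Icc.prod isCompact_Icc
  have hsubK : Icc a b ×ˢ Icc (0 : ℝ) r₀ ⊆ Ioi 0 ×ˢ univ := fun p hp => ⟨(hab' hp.1).1, mem_univ _⟩
  obtain ⟨A, hA⟩ := hcpt.exists_bound_of_continuousOn ((continuousOn_heatProfileTime d).mono hsubK)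
  obtain ⟨B, hB⟩ := hcpt.exists_bound_of_continuousOn
    (((continuousOn_heatProfile d).sub (continuousOn_const (c := (1 : ℝ)))).mono hsubK)
  obtain ⟨M, hM⟩ := hcpt.exists_bound_of_continuousOn
    (H.cont.mono (prod_mono_left hab))
  obtain ⟨N, hN⟩ := hcpt.exists_bound_of_continuousOn
    (H.cont_source.mono (prod_mono_left hab))
  have hmem : ((s, 0) : ℝ × ℝ) ∈ Icc a b ×ˢ Icc (0 : ℝ) r₀ := ⟨⟨has.le, hsb.le⟩, ⟨le_rfl, hr0⟩⟩
  have hA0 := (norm_nonneg _).trans (hA _ hmem)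
  have hB0 := (norm_nonneg _).trans (hB _ hmem)
  have hM0 := (norm_nonneg _).trans (hM _ hmem)
  have hN0 := (norm_nonneg _).trans (hN _ hmem)
  have hcont : ∀ x ∈ Icc a b, ContinuousOn
      (fun r => r ^ (d - 1) * (max (heatProfile d x r - 1) 0 * m x r)) (Icc 0 r₀) := by
    intro x hx
    have cK : Continuous (heatProfile d x) := continuous_iff_continuousAt.2 fun r =>
      (hasDerivAt_heatProfile_space d x r).continuousAt
    exact (by fun_prop : Continuous fun τ : ℝ => τ ^ (d - 1)).continuousOn.mul
      (((cK.sub continuous_const).max continuous_const).continuousOn.mul (H.cont_slice (hab hx)))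
  have hnhds : Icc a b ∈ 𝓝 s := Icc_mem_nhds has hsb
  have huIoc : uIoc (0 : ℝ) r₀ ⊆ Icc 0 r₀ := by rw [uIoc_of_le hr0]; exact Ioc_subset_Icc_self
  have hmeasG : AEStronglyMeasurable (fun r => r ^ (d - 1) *
        (heatProfileTime d s r * m s r - (heatProfile d s r - 1) * h s r))
        (volume.restrict (uIoc 0 r₀)) := by
    have hs' : s ∈ Icc (0 : ℝ) 1 := Ioo_subset_Icc_self hs
    have cK : Continuous (heatProfile d s) := continuous_iff_continuousAt.2 fun r =>
      (hasDerivAt_heatProfile_space d s r).continuousAt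
    have cKt : Continuous (heatProfileTime d s) := by
      unfold heatProfileTime; fun_prop
    exact (((by fun_prop : Continuous fun τ : ℝ => τ ^ (d - 1)).continuousOn.mul
      ((cKt.continuousOn.mul (H.cont_slice hs')).sub ((cK.sub continuous_const).continuousOn.mul
        (H.cont_source_slice hs')))).mono huIoc).aestronglyMeasurable measurableSet_uIoc
  -- The positive part is Lipschitz in s but not differentiable at the edge, so the Lipschitz form
  -- of differentiation under the integral is used. The constant is the product rule bound: A and N
  -- bound the time derivatives of K and m, while B and M bound K - 1 and m.
  have key := intervalIntegral.hasDerivAt_integral_of_dominated_loc_of_lip (μ := volume)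
    (a := 0) (b := r₀) (x₀ := s) (s := Icc a b)
    (F := fun s r => r ^ (d - 1) * (max (heatProfile d s r - 1) 0 * m s r))
    (F' := indicator {r | r ≤ ballRadius d s} fun r => r ^ (d - 1) *
        (heatProfileTime d s r * m s r - (heatProfile d s r - 1) * h s r))
    (bound := fun _ => r₀ ^ (d - 1) * (A * M + B * N)) hnhds ?_ ?_ ?_ ?_ ?_ ?_
  · rw [intervalIntegral.integral_indicator ⟨ballRadius_nonneg d s, hr₀ s (Ioo_subset_Icc_self hs)⟩,
      H.integral_section hd hs (hr₀ s (Ioo_subset_Icc_self hs))] at key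
    exact key.2
  · filter_upwards [hnhds] with x hx
    exact ((hcont x hx).mono huIoc).aestronglyMeasurable measurableSet_uIoc
  · exact (hcont s ⟨has.le, hsb.le⟩).intervalIntegrable_of_Icc hr0
  · exact hmeasG.indicator measurableSet_Iic
  · refine Eventually.of_forall fun r hr => ?_
    have hr := huIoc hr
    refine LipschitzOnWith.of_dist_le_mul fun x hx y hy => ?_
    have lipK : |heatProfile d x r - heatProfile d y r| ≤ A * |x - y| := by
      have := (convex_Icc a b).norm_image_sub_le_of_norm_hasDerivWithin_le
        (f := fun s => heatProfile d s r) (f' := fun s => heatProfileTime d s r) (C := A)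
        (fun z hz => (hasDerivAt_heatProfile_time d (hab' hz).1 r).hasDerivWithinAt)
        (fun z hz => hA (z, r) ⟨hz, hr⟩) hy hx
      simpa [Real.norm_eq_abs] using this
    have lipm : |m x r - m y r| ≤ N * |x - y| := by
      have := (convex_Icc a b).norm_image_sub_le_of_norm_hasDerivWithin_le
        (f := fun s => m s r) (f' := fun s => -h s r) (C := N)
        (fun z hz => (H.deriv_time z (hab' hz) r hr).hasDerivWithinAt)
        (fun z hz => by rw [norm_neg]; exact hN (z, r) ⟨hz, hr⟩) hy hx
      simpa [Real.norm_eq_abs] using this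
    have lipmax : |max (heatProfile d x r - 1) 0 - max (heatProfile d y r - 1) 0| ≤ A * |x - y| := by
      refine (abs_max_sub_max_le_abs _ _ _).trans ?_
      simpa using lipK
    have bm : |m x r| ≤ M := hM (x, r) ⟨hx, hr⟩
    have bK : |max (heatProfile d y r - 1) 0| ≤ B := by
      have h1 : |heatProfile d y r - 1| ≤ B := hB (y, r) ⟨hy, hr⟩
      rw [abs_of_nonneg (le_max_right _ _)]
      exact max_le ((le_abs_self _).trans h1) hB0
    have hc0 : 0 ≤ r₀ ^ (d - 1) * (A * M + B * N) := by positivity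
    rw [Real.coe_nnabs, abs_of_nonneg hc0, Real.dist_eq, Real.dist_eq, ← mul_sub, abs_mul,
      abs_of_nonneg (pow_nonneg hr.1 _), mul_assoc]
    have e : max (heatProfile d x r - 1) 0 * m x r - max (heatProfile d y r - 1) 0 * m y r =
        (max (heatProfile d x r - 1) 0 - max (heatProfile d y r - 1) 0) * m x r +
        max (heatProfile d y r - 1) 0 * (m x r - m y r) := by ring
    have : |max (heatProfile d x r - 1) 0 * m x r - max (heatProfile d y r - 1) 0 * m y r| ≤
        (A * M + B * N) * |x - y| := by
      rw [e]
      refine (abs_add_le _ _).trans ?_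
      rw [abs_mul, abs_mul]
      calc _ ≤ A * |x - y| * M + B * (N * |x - y|) := by gcongr
        _ = _ := by ring
    have hp : r ^ (d - 1) ≤ r₀ ^ (d - 1) := by have := hr.1; have := hr.2; gcongr
    exact mul_le_mul hp this (abs_nonneg _) (pow_nonneg hr0 _)
  · exact intervalIntegrable_const
  -- The edge of the section is a single radius, hence negligible. On either side of it the sign of
  -- K - 1 is locally constant in s.
  · have : ∀ᵐ r : ℝ, r ≠ ballRadius d s := by
      simp [ae_iff]
    filter_upwards [this] with r hne hr
    have hr := huIoc hr
    have d1 := hasDerivAt_heatProfile_time d hs.1 r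
    have d2 := H.deriv_time s hs r hr
    rcases hne.lt_or_gt with hlt | hgt
    · rw [indicator_of_mem (show r ∈ {r | r ≤ ballRadius d s} from hlt.le)]
      refine ((((d1.sub_const 1).mul d2).const_mul (r ^ (d - 1))).congr_deriv (by ring)).congr_of_eventuallyEq ?_
      have h1 := one_lt_heatProfile d ⟨hs.1, hs.2.le⟩ hr.1 hlt
      filter_upwards [d1.continuousAt.eventually (lt_mem_nhds h1)] with x hx
      rw [max_eq_left (by linarith)]; rfl
    · rw [indicator_of_notMem (show r ∉ {r | r ≤ ballRadius d s} from not_le.2 hgt)]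
      refine (hasDerivAt_const s (0 : ℝ)).congr_of_eventuallyEq ?_
      have h1 := heatProfile_lt_one d ⟨hs.1, hs.2.le⟩ hgt
      filter_upwards [d1.continuousAt.eventually (gt_mem_nhds h1)] with x hx
      rw [max_eq_right (by linarith)]; simp

end HeatWalk

/-! ### The exit time density and the mean value property for spherical means. -/

namespace HeatWalk

/-- The (unnormalized) density of the time component of the exit law from a unit heat ball. -/
noncomputable def heatWeight (d : ℕ) (s : ℝ) : ℝ := ballRadius d s ^ d / (2 * s)

lemma heatWeight_nonneg (d : ℕ) {s : ℝ} (hs : 0 ≤ s) : 0 ≤ heatWeight d s :=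
  div_nonneg (pow_nonneg (ballRadius_nonneg d s) _) (by linarith)

lemma image_exp_neg_Ioi : (fun z : ℝ => Real.exp (-z)) '' Ioi 0 = Ioo 0 1 := by
  ext s
  constructor
  · rintro ⟨z, hz, rfl⟩
    exact ⟨Real.exp_pos _, Real.exp_lt_one_iff.2 (neg_neg_iff_pos.2 hz)⟩
  · intro hs
    exact ⟨-Real.log s, neg_pos.2 (Real.log_neg hs.1 hs.2), by simp [Real.exp_log hs.1]⟩

/-- The substitution s = e^{-z} gives ρ² = 2d z e^{-z}, and the Jacobian cancels the 1/s of the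
weight: what remains is a Gamma density of shape d/2+1, tilted by e^{-pz}. -/
lemma heatWeight_exp_neg (d p : ℕ) {z : ℝ} (hz : 0 < z) :
    |-Real.exp (-z)| • (Real.exp (-z) ^ p * heatWeight d (Real.exp (-z))) =
      (2 * d : ℝ) ^ (d / 2 : ℝ) / 2 *
        (z ^ ((d / 2 + 1 : ℝ) - 1) * Real.exp (-((p + d / 2 : ℝ) * z))) := by
  have he := Real.exp_pos (-z)
  have hs : Real.exp (-z) ∈ Icc (0 : ℝ) 1 := ⟨he.le, (Real.exp_lt_one_iff.2 (by linarith)).le⟩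
  have h2 : ballRadius d (Real.exp (-z)) ^ 2 = 2 * d * z * Real.exp (-z) := by
    rw [ballRadius, mul_pow, psi_sq d hs, Real.log_exp]; ring
  have h3 : ballRadius d (Real.exp (-z)) ^ d =
      (2 * d : ℝ) ^ (d / 2 : ℝ) * z ^ (d / 2 : ℝ) * Real.exp (-((d / 2 : ℝ) * z)) := by
    have : ballRadius d (Real.exp (-z)) ^ d =
        (ballRadius d (Real.exp (-z)) ^ 2) ^ (d / 2 : ℝ) := by
      rw [← Real.rpow_natCast _ 2, ← Real.rpow_mul (ballRadius_nonneg _ _), ← Real.rpow_natCast]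
      congr 1; push_cast; ring
    rw [this, h2, Real.mul_rpow (by positivity) he.le, Real.mul_rpow (by positivity) hz.le,
      ← Real.exp_mul]
    congr 2; ring
  have h4 : Real.exp (-((p + d / 2 : ℝ) * z)) = Real.exp (-z) ^ p * Real.exp (-((d / 2 : ℝ) * z)) := by
    rw [← Real.exp_nat_mul, ← Real.exp_add]; congr 1; ring
  rw [heatWeight, h3, h4, abs_neg, abs_of_pos he, smul_eq_mul, add_sub_cancel_right]
  field_simp

lemma hasDerivWithinAt_exp_neg (z : ℝ) (S : Set ℝ) :
    HasDerivWithinAt (fun z : ℝ => Real.exp (-z)) (-Real.exp (-z)) S z := by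
  have := ((hasDerivAt_neg z).exp).hasDerivWithinAt (s := S)
  simpa using this

lemma injOn_exp_neg (S : Set ℝ) : InjOn (fun z : ℝ => Real.exp (-z)) S :=
  fun _ _ _ _ h => neg_injective (Real.exp_injective h)

/-- The moments of the exit time law, up to normalization. -/
lemma integral_pow_mul_heatWeight {d : ℕ} (hd : 0 < d) (p : ℕ) :
    ∫ s in Ioo (0 : ℝ) 1, s ^ p * heatWeight d s =
      (2 * d : ℝ) ^ (d / 2 : ℝ) / 2 * Real.Gamma (d / 2 + 1) *
        (1 / (p + d / 2 : ℝ)) ^ (d / 2 + 1 : ℝ) := by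
  have hd' : (0 : ℝ) < d := Nat.cast_pos.2 hd
  rw [← image_exp_neg_Ioi, integral_image_eq_integral_abs_deriv_smul measurableSet_Ioi
    (fun z _ => hasDerivWithinAt_exp_neg z _) (injOn_exp_neg _),
    setIntegral_congr_fun measurableSet_Ioi fun z hz => heatWeight_exp_neg d p hz,
    integral_const_mul, Real.integral_rpow_mul_exp_neg_mul_Ioi (by positivity) (by positivity)]
  ring

lemma integral_heatWeight_pos {d : ℕ} (hd : 0 < d) : 0 < ∫ s in Ioo (0 : ℝ) 1, heatWeight d s := by
  have := integral_pow_mul_heatWeight hd 0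
  simp only [pow_zero, one_mul] at this
  rw [this]
  have hd' : (0 : ℝ) < d := Nat.cast_pos.2 hd
  have := Real.Gamma_pos_of_pos (s := d / 2 + 1) (by positivity)
  positivity

/-- A non-integrable function has integral 0 by convention, so the positive value found from the
Gamma integral already yields integrability. -/
lemma integrableOn_heatWeight {d : ℕ} (hd : 0 < d) : IntegrableOn (heatWeight d) (Ioo 0 1) :=
  Integrable.of_integral_ne_zero (integral_heatWeight_pos hd).ne'

lemma intervalIntegrable_heatWeight {d : ℕ} (hd : 0 < d) :
    IntervalIntegrable (heatWeight d) volume 0 1 := by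
  rw [intervalIntegrable_iff_integrableOn_Ioo_of_le zero_le_one]
  exact integrableOn_heatWeight hd

variable {d : ℕ} {r₀ : ℝ} {m h q : ℝ → ℝ → ℝ}

lemma continuousOn_sphere_section (hr₀ : ∀ s ∈ Icc (0 : ℝ) 1, ballRadius d s ≤ r₀)
    (hm : ContinuousOn (fun p : ℝ × ℝ => m p.1 p.2) (Icc 0 1 ×ˢ Icc 0 r₀)) :
    ContinuousOn (fun s => m s (ballRadius d s)) (Icc 0 1) :=
  hm.comp (f := fun s => (s, ballRadius d s))
    (continuousOn_id.prodMk ((continuousOn_ballRadius d).mono Icc_subset_Ici_self))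
    fun s hs => ⟨hs, ballRadius_nonneg d s, hr₀ s hs⟩

/-- Integrates the derivative of the section mass down from s = 1. Stopping at ε > 0 avoids the
singularity of the kernel at s = 0. -/
lemma IsRadialCaloric.sectionMass_eq (hd : 0 < d) (H : IsRadialCaloric d r₀ m h q)
    (hr₀ : ∀ s ∈ Icc (0 : ℝ) 1, ballRadius d s ≤ r₀) {ε : ℝ} (hε : ε ∈ Ioo (0 : ℝ) 1) :
    sectionMass d r₀ m ε = ∫ s in ε..1, heatWeight d s * m s (ballRadius d s) := by
  have hr0 : 0 ≤ r₀ := (ballRadius_nonneg d ε).trans (hr₀ ε (Ioo_subset_Icc_self hε))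
  have hsub : Icc ε 1 ⊆ Icc (0 : ℝ) 1 := Icc_subset_Icc_left hε.1.le
  have hcw : ContinuousOn (heatWeight d) (Icc ε 1) := by
    refine ContinuousOn.div (((continuousOn_ballRadius d).mono (hsub.trans Icc_subset_Ici_self)).pow d)
      (by fun_prop) fun s hs => ?_
    have : 0 < s := hε.1.trans_le hs.1
    positivity
  -- At s = 1 the kernel is exp(-r²/4) ≤ 1, so the section is reduced to a point.
  have h1 : sectionMass d r₀ m 1 = 0 := by
    rw [sectionMass, intervalIntegral.integral_congr (g := fun _ => (0 : ℝ))]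
    · simp
    · intro r _
      have : heatProfile d 1 r ≤ 1 := by
        rw [heatProfile, Real.one_rpow, one_mul, Real.exp_le_one_iff]
        have := sq_nonneg r
        linarith
      simp [max_eq_right (sub_nonpos.2 this)]
  have hcont : ContinuousOn (sectionMass d r₀ m) (Icc ε 1) := by
    unfold sectionMass
    have : ContinuousOn (fun p : ℝ × ℝ => p.2 ^ (d - 1) * (max (heatProfile d p.1 p.2 - 1) 0 *
        m p.1 p.2)) (Icc ε 1 ×ˢ Icc 0 r₀) := by
      refine (by fun_prop : Continuous fun p : ℝ × ℝ => p.2 ^ (d - 1)).continuousOn.mul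
        (ContinuousOn.mul ?_ (H.cont.mono (prod_mono_left hsub)))
      have hK := (continuousOn_heatProfile d).mono
        (fun p hp => ⟨hε.1.trans_le hp.1.1, mem_univ _⟩ : Icc ε 1 ×ˢ Icc 0 r₀ ⊆ Ioi 0 ×ˢ univ)
      exact (by fun_prop : Continuous fun x : ℝ => max (x - 1) 0).comp_continuousOn hK
    obtain ⟨C, hC⟩ := (isCompact_Icc.prod isCompact_Icc).exists_bound_of_continuousOn this
    intro s hs
    refine intervalIntegral.continuousWithinAt_of_dominated_interval (bound := fun _ => C) ?_ ?_ ?_ ?_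
    · filter_upwards [self_mem_nhdsWithin] with x hx
      refine ContinuousOn.aestronglyMeasurable (ContinuousOn.mono (s := Icc 0 r₀) ?_ ?_)
        measurableSet_uIoc
      · exact this.comp (f := fun r => (x, r)) (by fun_prop) fun r hr => ⟨hx, hr⟩
      · rw [uIoc_of_le hr0]; exact Ioc_subset_Icc_self
    · filter_upwards [self_mem_nhdsWithin] with x hx
      refine Eventually.of_forall fun r hr => hC (x, r) ⟨hx, ?_⟩
      rw [uIoc_of_le hr0] at hr; exact Ioc_subset_Icc_self hr
    · exact intervalIntegrable_const
    · refine Eventually.of_forall fun r hr => ?_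
      rw [uIoc_of_le hr0] at hr
      exact this.comp (f := fun x => (x, r)) (by fun_prop)
        (fun x hx => ⟨hx, Ioc_subset_Icc_self hr⟩) s hs
  have key := intervalIntegral.integral_eq_sub_of_hasDerivAt_of_le hε.2.le hcont
    (fun s hs => H.hasDerivAt_sectionMass hd hr₀ ⟨hε.1.trans hs.1, hs.2⟩) ?_
  · rw [h1, intervalIntegral.integral_neg, zero_sub, neg_inj] at key
    exact key.symm
  · refine ContinuousOn.intervalIntegrable_of_Icc hε.2.le ?_
    exact (hcw.mul ((continuousOn_sphere_section hr₀ H.cont).mono hsub)).neg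

/-- Constants serve as a reference: applied to them, `IsRadialCaloric.sectionMass_eq` computes the
kernel mass of a section, which therefore never has to be evaluated near s = 0. -/
lemma isRadialCaloric_const (d : ℕ) (r₀ c : ℝ) :
    IsRadialCaloric d r₀ (fun _ _ => c) (fun _ _ => 0) (fun _ _ => 0) where
  cont := continuousOn_const
  cont_source := continuousOn_const
  deriv_time s _ r _ := by simpa using hasDerivAt_const s c
  deriv_space s _ r _ := hasDerivAt_const r c
  flux s _ r _ := by simp

/-- The mean value property over the heat sphere, for spherical means. -/
theorem IsRadialCaloric.integral_heatWeight_mul (hd : 0 < d) (H : IsRadialCaloric d r₀ m h q)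
    (hr₀ : ∀ s ∈ Icc (0 : ℝ) 1, ballRadius d s ≤ r₀) :
    ∫ s in (0 : ℝ)..1, heatWeight d s * m s (ballRadius d s) =
      (∫ s in (0 : ℝ)..1, heatWeight d s) * m 0 0 := by
  have h01 : (0 : ℝ) ∈ Icc (0 : ℝ) 1 := ⟨le_rfl, zero_le_one⟩
  have hr0 : 0 ≤ r₀ := (ballRadius_nonneg d 0).trans (hr₀ 0 h01)
  have hcs := continuousOn_sphere_section hr₀ H.cont
  have hw := intervalIntegrable_heatWeight hd
  have hwm : IntervalIntegrable (fun s => heatWeight d s * m s (ballRadius d s)) volume 0 1 :=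
    hw.mul_continuousOn (by rwa [uIcc_of_le zero_le_one])
  set I : ℝ := ∫ s in (0 : ℝ)..1, heatWeight d s
  have hI0 : 0 ≤ I := intervalIntegral.integral_nonneg zero_le_one
    fun s hs => heatWeight_nonneg d hs.1
  have hlim : Tendsto (fun ε => (∫ s in ε..1, heatWeight d s * m s (ballRadius d s)) -
      (∫ s in ε..1, heatWeight d s) * m 0 0) (𝓝[>] 0)
      (𝓝 ((∫ s in (0 : ℝ)..1, heatWeight d s * m s (ballRadius d s)) - I * m 0 0)) := by
    have key : ∀ g : ℝ → ℝ, IntervalIntegrable g volume 0 1 →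
        Tendsto (fun ε => ∫ s in ε..1, g s) (𝓝[>] 0) (𝓝 (∫ s in (0 : ℝ)..1, g s)) := by
      intro g hg
      have hc := intervalIntegral.continuousOn_primitive_interval' (b₁ := 0) (b₂ := 1) (a := 1) hg
        right_mem_uIcc
      rw [uIcc_of_le zero_le_one] at hc
      have := (hc 0 h01).neg.tendsto.mono_left
        (nhdsWithin_le_iff.2 (Icc_mem_nhdsGT_of_mem ⟨le_rfl, zero_lt_one⟩))
      simpa only [Pi.neg_def, ← intervalIntegral.integral_symm] using this
    exact (key _ hwm).sub ((key _ hw).mul_const _)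
  refine sub_eq_zero.1 (tendsto_nhds_unique hlim ?_)
  have hcr : Tendsto (ballRadius d) (𝓝[>] 0) (𝓝 0) := by
    have := (continuousOn_ballRadius d 0 (mem_Ici.2 le_rfl)).mono (Ioi_subset_Ici_self)
    have h0 : ballRadius d 0 = 0 := by simp [ballRadius, psi_zero]
    simpa [ContinuousWithinAt, h0] using this
  rw [Metric.tendsto_nhds]
  intro η hη
  -- Adding 1 gives a strict final inequality and only requires I ≥ 0.
  have hη' : 0 < η / (I + 1) := by positivity
  obtain ⟨δ, hδ, hδm⟩ := Metric.continuousWithinAt_iff.1 (H.cont (0, 0) ⟨h01, le_rfl, hr0⟩) _ hη'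
  filter_upwards [hcr.eventually (gt_mem_nhds hδ), Ioo_mem_nhdsGT hδ,
    Ioo_mem_nhdsGT zero_lt_one] with ε h1 h2 h3
  have h3' : ε ∈ Icc (0 : ℝ) 1 := Ioo_subset_Icc_self h3
  -- The difference to be bounded is the section mass of m - m(0,0). In the section of time ε all
  -- radii are below δ, so this is at most η/(I+1) times the section mass of 1.
  have e1 := H.sectionMass_eq hd hr₀ h3
  have e2 := (isRadialCaloric_const d r₀ 1).sectionMass_eq hd hr₀ h3
  have e3 := (isRadialCaloric_const d r₀ (m 0 0)).sectionMass_eq hd hr₀ h3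
  simp only [mul_one, intervalIntegral.integral_mul_const] at e2 e3
  have cK : Continuous (heatProfile d ε) := continuous_iff_continuousAt.2 fun r =>
      (hasDerivAt_heatProfile_space d ε r).continuousAt
  have ii : ∀ g : ℝ → ℝ, ContinuousOn g (Icc 0 r₀) → IntervalIntegrable
      (fun r => r ^ (d - 1) * (max (heatProfile d ε r - 1) 0 * g r)) volume 0 r₀ := fun g hg =>
    ContinuousOn.intervalIntegrable_of_Icc hr0
      ((by fun_prop : Continuous fun τ : ℝ => τ ^ (d - 1)).continuousOn.mul
      (((cK.sub continuous_const).max continuous_const).continuousOn.mul hg))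
  have le1 : ∫ s in ε..1, heatWeight d s ≤ I :=
    intervalIntegral.integral_mono_interval h3.1.le h3.2.le le_rfl
      ((ae_restrict_iff' measurableSet_Ioc).2
        (Eventually.of_forall fun s hs => heatWeight_nonneg d hs.1.le)) hw
  rw [← e1, ← e3, dist_zero_right, sectionMass, sectionMass,
    ← intervalIntegral.integral_sub (ii _ (H.cont_slice h3')) (ii _ continuousOn_const)]
  calc _ ≤ ∫ r in (0 : ℝ)..r₀, r ^ (d - 1) * (max (heatProfile d ε r - 1) 0 * (η / (I + 1))) := by
        refine intervalIntegral.norm_integral_le_of_norm_le hr0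
          (Eventually.of_forall fun r hr => ?_) (ii _ continuousOn_const)
        have hr' : r ∈ Icc 0 r₀ := Ioc_subset_Icc_self hr
        rw [← mul_sub, ← mul_sub, norm_mul, norm_mul, Real.norm_of_nonneg (pow_nonneg hr'.1 _),
          Real.norm_of_nonneg (le_max_right _ _)]
        rcases le_or_gt r (ballRadius d ε) with hle | hgt
        · have hr0' := pow_nonneg hr'.1 (d - 1)
          gcongr
          have := @hδm (ε, r) ⟨h3', hr'⟩ (by
            rw [Prod.dist_eq, max_lt_iff]
            simp only [dist_zero_right, Real.norm_eq_abs, abs_of_pos h3.1, abs_of_nonneg hr'.1]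
            exact ⟨h2.2, hle.trans_lt h1⟩)
          exact this.le
        · rw [max_eq_right (by have := heatProfile_lt_one d ⟨h3.1, h3.2.le⟩ hgt; linarith)]
          simp
    _ = (∫ s in ε..1, heatWeight d s) * (η / (I + 1)) := by
        rw [← e2, sectionMass, ← intervalIntegral.integral_mul_const]
        congr 1; ext r; ring
    _ ≤ I * (η / (I + 1)) := by gcongr
    _ < η := by
        rw [mul_div_assoc', div_lt_iff₀ (by positivity)]; nlinarith

end HeatWalk

/-! ### Polar coordinates and continuity of spherical integrals. -/

namespace HeatWalk

lemma homeomorphUnitSphereProd_snd_smul_fst {d : ℕ} (x : ({0}ᶜ : Set (E d))) :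
    ((homeomorphUnitSphereProd (E d) x).2 : ℝ) • ((homeomorphUnitSphereProd (E d) x).1 : E d) = x := by
  rw [← homeomorphUnitSphereProd_symm_apply_coe, Homeomorph.symm_apply_apply]

/-- Integration in polar coordinates. -/
lemma integral_polar {d : ℕ} (hd : 0 < d) {F : E d → ℝ} (hF : Integrable F) :
    ∫ y, F y = ∫ r in Ioi (0 : ℝ), r ^ (d - 1) *
      ∫ v : Metric.sphere (0 : E d) 1, F (r • (v : E d)) ∂(volume : Measure (E d)).toSphere := by
  have : Nonempty (Fin d) := ⟨⟨0, hd⟩⟩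
  have hmp := (volume : Measure (E d)).measurePreserving_homeomorphUnitSphereProd
  have hemb := (homeomorphUnitSphereProd (E d)).measurableEmbedding
  set G : Metric.sphere (0 : E d) 1 × Ioi (0 : ℝ) → ℝ := fun p => F (p.2.1 • (p.1 : E d)) with hG
  have hcomp : ∀ x : ({0}ᶜ : Set (E d)), G (homeomorphUnitSphereProd (E d) x) = F x := fun x => by
    simp only [hG]; rw [homeomorphUnitSphereProd_snd_smul_fst]
  have hint : Integrable G ((volume : Measure (E d)).toSphere.prod
      (Measure.volumeIoiPow (Module.finrank ℝ (E d) - 1))) := by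
    rw [← hmp.integrable_comp_emb hemb]
    have : G ∘ homeomorphUnitSphereProd (E d) = F ∘ (Subtype.val : ({0}ᶜ : Set (E d)) → E d) :=
      funext hcomp
    rw [this, ← integrableOn_iff_comap_subtypeVal (measurableSet_singleton _).compl]
    exact hF.integrableOn
  calc ∫ y, F y = ∫ x : ({0}ᶜ : Set (E d)), F x ∂(volume.comap Subtype.val) := by
        rw [integral_subtype_comap (measurableSet_singleton _).compl F, restrict_compl_singleton]
    _ = ∫ p, G p ∂((volume : Measure (E d)).toSphere.prod
          (Measure.volumeIoiPow (Module.finrank ℝ (E d) - 1))) := by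
        rw [← hmp.integral_comp hemb]; exact integral_congr_ae (Eventually.of_forall fun x => (hcomp x).symm)
    _ = _ := by
        rw [integral_prod_symm _ hint]
        simp only [Measure.volumeIoiPow, ENNReal.ofReal, finrank_euclideanSpace, Fintype.card_fin]
        rw [integral_withDensity_eq_integral_smul,
          integral_subtype_comap measurableSet_Ioi fun a : ℝ => Real.toNNReal (a ^ (d - 1)) •
            ∫ v : Metric.sphere (0 : E d) 1, F (a • (v : E d)) ∂(volume : Measure (E d)).toSphere]
        · refine setIntegral_congr_fun measurableSet_Ioi fun x hx => ?_
          rw [NNReal.smul_def, Real.coe_toNNReal _ (pow_nonneg (le_of_lt hx) _), smul_eq_mul]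
        · exact (measurable_subtype_coe.pow_const _).real_toNNReal

lemma continuousOn_integral_sphere {d : ℕ} {X : Type*} [TopologicalSpace X]
    [FirstCountableTopology X] [LocallyCompactSpace X] [R1Space X] {S : Set X}
    (hS : IsLocallyClosed S) (μ : Measure (Metric.sphere (0 : E d) 1)) [IsFiniteMeasure μ]
    {F : X → Metric.sphere (0 : E d) 1 → ℝ}
    (hF : ContinuousOn (fun p : X × Metric.sphere (0 : E d) 1 => F p.1 p.2) (S ×ˢ univ)) :
    ContinuousOn (fun x => ∫ v, F x v ∂μ) S := by
  have := hS.locallyCompactSpace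
  rw [continuousOn_iff_continuous_domRestrict]
  have hc : Continuous (Function.uncurry fun (x : S) v => F x v) :=
    hF.comp_continuous (f := fun p : S × Metric.sphere (0 : E d) 1 => ((p.1 : X), p.2))
      (by fun_prop) fun p => ⟨p.1.2, mem_univ _⟩
  have := continuous_parametric_integral_of_continuous (μ := μ) hc isCompact_univ
  rw [Measure.restrict_univ] at this
  exact this

end HeatWalk

/-! ### Spherical means and radial test fields. -/

namespace HeatWalk

/-- The surface measure on the unit sphere. -/
noncomputable abbrev surface (d : ℕ) : Measure (Metric.sphere (0 : E d) 1) :=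
  (volume : Measure (E d)).toSphere

lemma add_smul_mem_ball {d : ℕ} {x : E d} {r R : ℝ} (v : Metric.sphere (0 : E d) 1)
    (hr : r ∈ Ioo (-R) R) : x + r • (v : E d) ∈ Metric.ball x R := by
  rw [Metric.mem_ball, dist_self_add_left, norm_smul, norm_eq_of_mem_sphere, mul_one]
  exact abs_lt.2 hr

lemma continuousOn_sphereMean {d : ℕ} {x : E d} {R : ℝ} {g : E d → Metric.sphere (0 : E d) 1 → ℝ}
    (μ : Measure (Metric.sphere (0 : E d) 1)) [IsFiniteMeasure μ]
    (hg : ContinuousOn (fun p : E d × Metric.sphere (0 : E d) 1 => g p.1 p.2)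
      (Metric.ball x R ×ˢ univ)) :
    ContinuousOn (fun r : ℝ => ∫ v, g (x + r • (v : E d)) v ∂μ) (Ioo (-R) R) := by
  refine continuousOn_integral_sphere isOpen_Ioo.isLocallyClosed μ
    (F := fun (r : ℝ) v => g (x + r • (v : E d)) v) ?_
  exact hg.comp (f := fun p : ℝ × Metric.sphere (0 : E d) 1 => (x + p.1 • (p.2 : E d), p.2))
    (by fun_prop) fun p hp => ⟨add_smul_mem_ball p.2 hp.1, mem_univ _⟩

variable {d : ℕ} {x : E d} {R : ℝ} {w : E d → ℝ}

lemma continuousOn_fderiv_of_contDiffOn_two (hw : ContDiffOn ℝ 2 w (Metric.ball x R)) :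
    ContinuousOn (fderiv ℝ w) (Metric.ball x R) :=
  hw.continuousOn_fderiv_of_isOpen Metric.isOpen_ball (by norm_num)

lemma continuousOn_flux_integrand (hw : ContDiffOn ℝ 2 w (Metric.ball x R)) :
    ContinuousOn (fun p : E d × Metric.sphere (0 : E d) 1 => fderiv ℝ w p.1 (p.2 : E d))
      (Metric.ball x R ×ˢ univ) :=
  ((continuousOn_fderiv_of_contDiffOn_two hw).comp continuousOn_fst fun _ hp => hp.1).clm_apply
    (by fun_prop)

/-- The radial derivative of a spherical mean. -/
lemma hasDerivAt_sphereMean (hw : ContDiffOn ℝ 2 w (Metric.ball x R)) {r : ℝ}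
    (hr : r ∈ Ioo (-R) R) :
    HasDerivAt (fun r : ℝ => ∫ v, w (x + r • (v : E d)) ∂surface d)
      (∫ v, fderiv ℝ w (x + r • (v : E d)) (v : E d) ∂surface d) r := by
  obtain ⟨a, ha1, ha2⟩ := exists_between hr.1
  obtain ⟨b, hb1, hb2⟩ := exists_between hr.2
  have hab : Icc a b ⊆ Ioo (-R) R := Icc_subset_Ioo ha1 hb2
  have hcomp : ∀ {g : E d → Metric.sphere (0 : E d) 1 → ℝ},
      ContinuousOn (fun p : E d × Metric.sphere (0 : E d) 1 => g p.1 p.2) (Metric.ball x R ×ˢ univ) →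
      ContinuousOn (fun p : ℝ × Metric.sphere (0 : E d) 1 => g (x + p.1 • (p.2 : E d)) p.2)
        (Ioo (-R) R ×ˢ univ) := fun hg =>
    hg.comp (f := fun p : ℝ × Metric.sphere (0 : E d) 1 => (x + p.1 • (p.2 : E d), p.2))
      (by fun_prop) fun p hp => ⟨add_smul_mem_ball p.2 hp.1, mem_univ _⟩
  have c0 := hcomp (g := fun y _ => w y) (hw.continuousOn.comp continuousOn_fst fun _ hp => hp.1)
  have c1 := hcomp (g := fun y v => fderiv ℝ w y v) (continuousOn_flux_integrand hw)
  have cs : ∀ {F : ℝ × Metric.sphere (0 : E d) 1 → ℝ}, ContinuousOn F (Ioo (-R) R ×ˢ univ) →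
      ∀ y ∈ Ioo (-R) R, Continuous fun v => F (y, v) := fun hF y hy =>
    hF.comp_continuous (by fun_prop) fun v => ⟨hy, mem_univ _⟩
  obtain ⟨C, hC⟩ := (isCompact_Icc.prod isCompact_univ).exists_bound_of_continuousOn
    (c1.mono (prod_mono_left hab))
  refine (hasDerivAt_integral_of_dominated_loc_of_deriv_le (bound := fun _ => C)
    (F := fun (r : ℝ) (v : Metric.sphere (0 : E d) 1) => w (x + r • (v : E d)))
    (F' := fun (r : ℝ) (v : Metric.sphere (0 : E d) 1) => fderiv ℝ w (x + r • (v : E d)) v)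
    (Icc_mem_nhds ha2 hb1) ?_ ?_ ?_ ?_ ?_ ?_).2
  · filter_upwards [Ioo_mem_nhds hr.1 hr.2] with y hy
    exact (cs c0 y hy).aestronglyMeasurable
  · exact (cs c0 r hr).integrable_of_hasCompactSupport (HasCompactSupport.of_compactSpace _)
  · exact (cs c1 r hr).aestronglyMeasurable
  · exact Eventually.of_forall fun v y hy => hC (y, v) ⟨hy, mem_univ _⟩
  · exact integrable_const _
  · refine Eventually.of_forall fun v y hy => ?_
    have h1 : HasFDerivAt w (fderiv ℝ w (x + y • (v : E d))) (x + y • (v : E d)) :=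
      ((hw.differentiableOn (by norm_num)).differentiableAt
        (Metric.isOpen_ball.mem_nhds (add_smul_mem_ball v (hab hy)))).hasFDerivAt
    have h2 : HasDerivAt (fun y : ℝ => x + y • (v : E d)) (v : E d) y := by
      simpa using ((hasDerivAt_id y).smul_const (v : E d)).const_add x
    exact h1.comp_hasDerivAt y h2

lemma hasFDerivAt_radial {χ ζ : ℝ → ℝ} (hχ : ∀ r, HasDerivAt χ (ζ r) r) {y : E d} (hy : y ≠ 0) :
    HasFDerivAt (fun y : E d => χ ‖y‖) ((ζ ‖y‖ * ‖y‖⁻¹) • innerSL ℝ y) y := by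
  have h1 : HasFDerivAt (fun y : E d => ‖y‖) (‖y‖⁻¹ • innerSL ℝ y) y := by
    have := ((hasStrictFDerivAt_norm_sq y).hasFDerivAt).sqrt (by positivity)
    simp only [Real.sqrt_sq (norm_nonneg _)] at this
    refine this.congr_fderiv ?_
    ext e
    simp
    field_simp
  refine ((hχ ‖y‖).comp_hasFDerivAt y h1).congr_fderiv ?_
  rw [smul_smul]

/-- The radial function with profile `χ` is smooth if `χ` is and is constant near `0`. -/
lemma contDiff_radial {χ : ℝ → ℝ} (hχ : ContDiff ℝ 1 χ) {a : ℝ} (ha : 0 < a)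
    (hconst : ∀ r < a, χ r = χ 0) : ContDiff ℝ 1 (fun y : E d => χ ‖y‖) := by
  rw [contDiff_iff_contDiffAt]
  intro y
  rcases eq_or_ne y 0 with rfl | hy
  · refine (contDiffAt_const (c := χ 0)).congr_of_eventuallyEq ?_
    filter_upwards [Metric.ball_mem_nhds (0 : E d) ha] with z hz
    exact hconst _ (by simpa using hz)
  · exact hχ.contDiffAt.comp y (contDiffAt_norm ℝ hy)

/-- Integration by parts against the constant 1. Summed over a basis, it says that a compactly
supported C¹ field has zero total divergence. -/
lemma integral_fderiv_apply_eq_zero {f : E d → ℝ} (hf : ContDiff ℝ 1 f) (hs : HasCompactSupport f)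
    (e : E d) : Integrable (fun y => fderiv ℝ f y e) ∧ ∫ y, fderiv ℝ f y e = 0 := by
  have hi : Integrable (fun y => fderiv ℝ f y e) :=
    ((hf.continuous_fderiv (by norm_num)).clm_apply continuous_const).integrable_of_hasCompactSupport
      (hs.fderiv_apply ℝ e)
  refine ⟨hi, ?_⟩
  have := integral_mul_fderiv_eq_neg_fderiv_mul_of_integrable (μ := volume) (f := fun _ => (1 : ℝ))
    (g := f) (v := e) (by simp) (by simpa using hi)
    (by simpa using hf.continuous.integrable_of_hasCompactSupport hs) (by fun_prop)
    (fun y _ => hf.differentiable (by norm_num) y)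
  simpa using this

end HeatWalk

namespace HeatWalk

variable {d : ℕ} {x : E d} {R : ℝ} {w : E d → ℝ}

lemma sum_inner_mul_clm_apply (y : E d) (L : E d →L[ℝ] ℝ) :
    ∑ i, inner ℝ y (EuclideanSpace.basisFun (Fin d) ℝ i) * L (EuclideanSpace.basisFun (Fin d) ℝ i) =
      L y := by
  conv_rhs => rw [← (EuclideanSpace.basisFun (Fin d) ℝ).sum_repr' y, map_sum]
  refine Finset.sum_congr rfl fun i _ => ?_
  rw [map_smul, smul_eq_mul, real_inner_comm]

lemma laplacian_eq_sum_fderiv_fderiv (hw : ContDiffOn ℝ 2 w (Metric.ball x R)) {y : E d}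
    (hy : y ∈ Metric.ball x R) :
    Laplacian.laplacian w y = ∑ i, fderiv ℝ (fun z => fderiv ℝ w z
      (EuclideanSpace.basisFun (Fin d) ℝ i)) y (EuclideanSpace.basisFun (Fin d) ℝ i) := by
  rw [InnerProductSpace.laplacian_eq_iteratedFDeriv_orthonormalBasis w
    (EuclideanSpace.basisFun (Fin d) ℝ)]
  refine Finset.sum_congr rfl fun i _ => ?_
  rw [iteratedFDeriv_two_apply]
  have h1 : DifferentiableAt ℝ (fderiv ℝ w) y :=
    ((hw.contDiffAt (Metric.isOpen_ball.mem_nhds hy)).fderiv_right (m := 1) (by norm_num)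
      ).differentiableAt (by norm_num)
  rw [fderiv_clm_apply h1 (by fun_prop)]
  simp

lemma continuousOn_laplacian (hw : ContDiffOn ℝ 2 w (Metric.ball x R)) :
    ContinuousOn (Laplacian.laplacian w) (Metric.ball x R) := by
  rw [InnerProductSpace.laplacian_eq_iteratedFDeriv_orthonormalBasis w
    (EuclideanSpace.basisFun (Fin d) ℝ)]
  have : ContinuousOn (iteratedFDeriv ℝ 2 w) (Metric.ball x R) := by
    refine (hw.continuousOn_iteratedFDerivWithin (by norm_num)
      Metric.isOpen_ball.uniqueDiffOn).congr fun y hy => ?_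
    exact (iteratedFDerivWithin_of_isOpen 2 Metric.isOpen_ball hy).symm
  exact continuousOn_finsetSum _ fun i _ =>
    (ContinuousMultilinearMap.apply ℝ (fun _ : Fin 2 => E d) ℝ _).continuous.comp_continuousOn this

/-- The weak form of Green's formula for radial test functions. -/
lemma integral_radial_test (hd : 0 < d) (hw : ContDiffOn ℝ 2 w (Metric.ball x R)) {χ ζ : ℝ → ℝ}
    (hχζ : ∀ r, HasDerivAt χ (ζ r) r) (hχ : ContDiff ℝ 1 χ) {a b : ℝ} (ha : 0 < a) (hb0 : 0 ≤ b)
    (hb : b < R) (hconst : ∀ r < a, χ r = χ 0) (hsupp : ∀ r, b ≤ r → χ r = 0) :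
    ∫ r in (0 : ℝ)..b, r ^ (d - 1) *
      (ζ r * (∫ v, fderiv ℝ w (x + r • (v : E d)) (v : E d) ∂surface d) +
        χ r * ∫ v, Laplacian.laplacian w (x + r • (v : E d)) ∂surface d) = 0 := by
  -- The components of the field χ(‖y‖) ∇w(x+y), which is C¹ on the whole space because χ is
  -- constant near 0 and vanishes beyond b < R. Its divergence is χ' times the radial derivative of
  -- w plus χ Δw; integrating it in polar coordinates gives the identity.
  set e := EuclideanSpace.basisFun (Fin d) ℝ
  set f : Fin d → E d → ℝ := fun i y => χ ‖y‖ * fderiv ℝ w (x + y) (e i) with hf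
  have hball : ∀ y : E d, ‖y‖ < R → x + y ∈ Metric.ball x R := fun y hy => by
    simpa [Metric.mem_ball] using hy
  have hX : ContDiff ℝ 1 (fun y : E d => χ ‖y‖) := contDiff_radial hχ ha hconst
  have hDw : ∀ i (y : E d), ‖y‖ < R → ContDiffAt ℝ 1 (fun y => fderiv ℝ w (x + y) (e i)) y := by
    intro i y hy
    have h1 : ContDiffAt ℝ 1 (fderiv ℝ w) (x + y) :=
      (hw.contDiffAt (Metric.isOpen_ball.mem_nhds (hball y hy))).fderiv_right (by norm_num)
    exact (h1.comp y (by fun_prop : ContDiffAt ℝ 1 (fun y => x + y) y)).clm_apply contDiffAt_const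
  have hzero : ∀ i (y : E d), b ≤ ‖y‖ → f i y = 0 := fun i y hy => by
    simp [hf, hsupp _ hy]
  have hfC : ∀ i, ContDiff ℝ 1 (f i) := by
    intro i
    rw [contDiff_iff_contDiffAt]
    intro y
    rcases lt_or_ge ‖y‖ R with hy | hy
    · exact hX.contDiffAt.mul (hDw i y hy)
    · refine (contDiffAt_const (c := (0 : ℝ))).congr_of_eventuallyEq ?_
      filter_upwards [continuous_norm.continuousAt.eventually (lt_mem_nhds (hb.trans_le hy))] with z hz
      exact hzero i z hz.le
  have hfS : ∀ i, HasCompactSupport (f i) := fun i =>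
    HasCompactSupport.intro (isCompact_closedBall (0 : E d) b) fun y hy =>
      hzero i y (by simp at hy; exact hy.le)
  have hint : Integrable (fun y => ∑ i, fderiv ℝ (f i) y (e i)) :=
    integrable_finsetSum _ fun i _ => (integral_fderiv_apply_eq_zero (hfC i) (hfS i) (e i)).1
  have hsum : ∫ y, ∑ i, fderiv ℝ (f i) y (e i) = 0 := by
    rw [integral_finsetSum _ fun i _ => (integral_fderiv_apply_eq_zero (hfC i) (hfS i) (e i)).1]
    exact Finset.sum_eq_zero fun i _ => (integral_fderiv_apply_eq_zero (hfC i) (hfS i) (e i)).2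
  have hval : ∀ y : E d, y ≠ 0 → ‖y‖ < R → ∑ i, fderiv ℝ (f i) y (e i) =
      ζ ‖y‖ * ‖y‖⁻¹ * fderiv ℝ w (x + y) y + χ ‖y‖ * Laplacian.laplacian w (x + y) := by
    intro y hy0 hyR
    rw [laplacian_eq_sum_fderiv_fderiv hw (hball y hyR), Finset.mul_sum,
      ← sum_inner_mul_clm_apply y (fderiv ℝ w (x + y)), Finset.mul_sum, ← Finset.sum_add_distrib]
    refine Finset.sum_congr rfl fun i _ => ?_
    have h1 := hasFDerivAt_radial hχζ hy0
    have h2 := ((hDw i y hyR).differentiableAt (by norm_num)).hasFDerivAt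
    have h12 : HasFDerivAt (f i) _ y := h1.mul h2
    rw [h12.fderiv]
    have h3 : fderiv ℝ (fun y => fderiv ℝ w (x + y) (e i)) y =
        fderiv ℝ (fun z => fderiv ℝ w z (e i)) (x + y) :=
      fderiv_comp_add_left (f := fun z => fderiv ℝ w z (e i)) x
    rw [h3]
    simp [-EuclideanSpace.basisFun_apply, e]
    ring
  have hfar : ∀ y : E d, b < ‖y‖ → ∑ i, fderiv ℝ (f i) y (e i) = 0 := by
    intro y hy
    refine Finset.sum_eq_zero fun i _ => ?_
    have : f i =ᶠ[𝓝 y] fun _ => 0 := by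
      filter_upwards [continuous_norm.continuousAt.eventually (lt_mem_nhds hy)] with z hz
      exact hzero i z hz.le
    rw [this.fderiv_eq]; simp
  have hw1 := continuousOn_flux_integrand hw
  have hlap := continuousOn_laplacian hw
  rw [integral_polar hd hint] at hsum
  rw [intervalIntegral.integral_of_le hb0]
  refine Eq.trans ?_ hsum
  have hU : Ioi (0 : ℝ) = Ioc 0 b ∪ Ioi b := (Ioc_union_Ioi_eq_Ioi hb0).symm
  have hz : ∀ r ∈ Ioi (0 : ℝ), r ∉ Ioc 0 b → r ^ (d - 1) * ∫ v : Metric.sphere (0 : E d) 1,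
      ∑ i, fderiv ℝ (f i) (r • (v : E d)) (e i) ∂surface d = 0 := by
    intro r hr hrb
    have hbr : b < r := by
      by_contra hcon
      exact hrb ⟨hr, not_lt.1 hcon⟩
    rw [integral_congr_ae (g := fun _ => (0 : ℝ))]
    · simp
    · refine Eventually.of_forall fun v => hfar _ ?_
      rw [norm_smul, norm_eq_of_mem_sphere, mul_one, Real.norm_of_nonneg (le_of_lt hr)]
      exact hbr
  rw [setIntegral_eq_of_subset_of_forall_sdiff_eq_zero measurableSet_Ioi Ioc_subset_Ioi_self
    fun r hr => hz r hr.1 hr.2]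
  refine setIntegral_congr_fun measurableSet_Ioc fun r hr => ?_
  have hr' : r ∈ Ioo (-R) R := ⟨by linarith [hr.1, hr.2], hr.2.trans_lt hb⟩
  have hmem : ∀ v : Metric.sphere (0 : E d) 1, x + r • (v : E d) ∈ Metric.ball x R := fun v =>
    add_smul_mem_ball v hr'
  have i1 : Integrable (fun v : Metric.sphere (0 : E d) 1 =>
      fderiv ℝ w (x + r • (v : E d)) (v : E d)) (surface d) :=
    (hw1.comp_continuous (f := fun v : Metric.sphere (0 : E d) 1 => (x + r • (v : E d), v))
      (by fun_prop) fun v => ⟨hmem v, mem_univ _⟩).integrable_of_hasCompactSupport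
      (HasCompactSupport.of_compactSpace _)
  have i2 : Integrable (fun v : Metric.sphere (0 : E d) 1 =>
      Laplacian.laplacian w (x + r • (v : E d))) (surface d) :=
    (hlap.comp_continuous (f := fun v : Metric.sphere (0 : E d) 1 => x + r • (v : E d))
      (by fun_prop) hmem).integrable_of_hasCompactSupport
      (HasCompactSupport.of_compactSpace _)
  rw [← integral_const_mul, ← integral_const_mul, ← integral_add (i1.const_mul _) (i2.const_mul _)]
  congr 1
  refine integral_congr_ae (Eventually.of_forall fun v => ?_)
  have hn : ‖r • (v : E d)‖ = r := by
    rw [norm_smul, norm_eq_of_mem_sphere, mul_one, Real.norm_of_nonneg hr.1.le]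
  have hv0 : r • (v : E d) ≠ 0 := by
    rw [← norm_ne_zero_iff, hn]; exact hr.1.ne'
  simp only []
  rw [hval _ hv0 (by rw [hn]; exact hr'.2), hn, map_smul, smul_eq_mul]
  have := hr.1.ne'
  field_simp

end HeatWalk

/-! ### The divergence theorem on balls. -/

namespace HeatWalk

variable {d : ℕ} {x : E d} {R : ℝ} {w : E d → ℝ}

/-- The divergence theorem on balls: the flux of `∇w` through a sphere is the integral of the
Laplacian over the ball. -/
lemma sphere_flux_eq (hd : 0 < d) (hw : ContDiffOn ℝ 2 w (Metric.ball x R)) {r : ℝ}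
    (hr : r ∈ Ioo 0 R) :
    r ^ (d - 1) * (∫ v, fderiv ℝ w (x + r • (v : E d)) (v : E d) ∂surface d) =
      ∫ τ in (0 : ℝ)..r, τ ^ (d - 1) *
        ∫ v, Laplacian.laplacian w (x + τ • (v : E d)) ∂surface d := by
  have hR : 0 < R := hr.1.trans hr.2
  set q : ℝ → ℝ := fun r => ∫ v, fderiv ℝ w (x + r • (v : E d)) (v : E d) ∂surface d
  set l : ℝ → ℝ := fun r => ∫ v, Laplacian.laplacian w (x + r • (v : E d)) ∂surface d
  set P : ℝ → ℝ := fun r => ∫ τ in (0 : ℝ)..r, τ ^ (d - 1) * l τ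
  have hsub : Ioo 0 R ⊆ Ioo (-R) R := Ioo_subset_Ioo_left (by linarith)
  have cq : ContinuousOn q (Ioo (-R) R) :=
    continuousOn_sphereMean (g := fun y v => fderiv ℝ w y (v : E d)) _ (continuousOn_flux_integrand hw)
  have cl : ContinuousOn l (Ioo (-R) R) :=
    continuousOn_sphereMean (g := fun y _ => Laplacian.laplacian w y) _
      ((continuousOn_laplacian hw).comp continuousOn_fst fun _ hp => hp.1)
  have cpow : Continuous fun τ : ℝ => τ ^ (d - 1) := by fun_prop
  have cl' : ContinuousOn (fun τ => τ ^ (d - 1) * l τ) (Ioo (-R) R) := cpow.continuousOn.mul cl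
  have hseg : ∀ s ∈ Ioo (-R) R, uIcc 0 s ⊆ Ioo (-R) R := fun s hs =>
    (convex_Ioo (-R) R).ordConnected.uIcc_subset ⟨by linarith, hR⟩ hs
  have dP : ∀ s ∈ Ioo (-R) R, HasDerivAt P (s ^ (d - 1) * l s) s := fun s hs =>
    intervalIntegral.integral_hasDerivAt_right ((cl'.mono (hseg s hs)).intervalIntegrable)
      (cl'.stronglyMeasurableAtFilter isOpen_Ioo s hs) (cl'.continuousAt (isOpen_Ioo.mem_nhds hs))
  have cP : ContinuousOn P (Ioo (-R) R) := fun s hs => (dP s hs).continuousAt.continuousWithinAt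
  have cf : ContinuousOn (fun r => r ^ (d - 1) * q r - P r) (Ioo (-R) R) :=
    (cpow.continuousOn.mul cq).sub cP
  -- Fundamental lemma of the calculus of variations: it suffices to test the difference against
  -- smooth g with compact support in (0,R).
  have key : ∀ᵐ r : ℝ, r ∈ Ioo 0 R → r ^ (d - 1) * q r - P r = 0 := by
    refine isOpen_Ioo.ae_eq_zero_of_integral_contDiff_smul_eq_zero
      ((cf.mono hsub).locallyIntegrableOn measurableSet_Ioo) fun g hg hgc hgs => ?_
    obtain ⟨a, b, ha, hb0, hbR, hga, hgb⟩ : ∃ a b : ℝ, 0 < a ∧ 0 < b ∧ b < R ∧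
        (∀ r ≤ a, g r = 0) ∧ ∀ r, b ≤ r → g r = 0 := by
      have hgz : ∀ r, r ∉ tsupport g → g r = 0 := fun r hr => image_eq_zero_of_notMem_tsupport hr
      rcases (tsupport g).eq_empty_or_nonempty with he | hne
      · exact ⟨R / 2, R / 2, by linarith, by linarith, by linarith,
          fun r _ => hgz r (by simp [he]), fun r _ => hgz r (by simp [he])⟩
      · obtain ⟨a, haS, ha⟩ := hgc.exists_isLeast hne
        obtain ⟨b, hbS, hb⟩ := hgc.exists_isGreatest hne
        obtain ⟨a', ha1, ha2⟩ := exists_between (hgs haS).1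
        obtain ⟨b', hb1, hb2⟩ := exists_between (hgs hbS).2
        exact ⟨a', b', ha1, (hgs hbS).1.trans hb1, hb2,
          fun r hr => hgz r fun h => absurd (ha h) (not_le.2 (hr.trans_lt ha2)),
          fun r hr => hgz r fun h => absurd (hb h) (not_le.2 (hb1.trans_le hr))⟩
    have hgcont : Continuous g := hg.continuous
    -- The primitive of g based at b vanishes beyond b and is constant below a, hence is an
    -- admissible radial profile with derivative g.
    set χ : ℝ → ℝ := fun r => ∫ τ in b..r, g τ
    have dχ : ∀ r, HasDerivAt χ (g r) r := fun r =>
      intervalIntegral.integral_hasDerivAt_right (hgcont.intervalIntegrable _ _)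
        (hgcont.stronglyMeasurableAtFilter _ _) hgcont.continuousAt
    have cχ : ContDiff ℝ 1 χ := by
      rw [contDiff_one_iff_deriv]
      refine ⟨fun r => (dχ r).differentiableAt, ?_⟩
      rwa [show deriv χ = g from funext fun r => (dχ r).deriv]
    have χconst : ∀ r < a, χ r = χ 0 := by
      intro r hr
      have : χ r - χ 0 = ∫ τ in (0 : ℝ)..r, g τ := intervalIntegral.integral_interval_sub_left
        (hgcont.intervalIntegrable _ _) (hgcont.intervalIntegrable _ _)
      rw [← sub_eq_zero, this, intervalIntegral.integral_congr (g := fun _ => (0 : ℝ))]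
      · simp
      · exact fun τ hτ => hga τ (hτ.2.trans (max_le ha.le hr.le))
    have χzero : ∀ r, b ≤ r → χ r = 0 := by
      intro r hr
      simp only [χ]
      rw [intervalIntegral.integral_congr (g := fun _ => (0 : ℝ))]
      · simp
      · intro τ hτ
        rw [uIcc_of_le hr] at hτ
        exact hgb τ hτ.1
    have hI : Icc 0 b ⊆ Ioo (-R) R := Icc_subset_Ioo (by linarith) hbR
    have hIu : uIcc 0 b ⊆ Ioo (-R) R := by rwa [uIcc_of_le hb0.le]
    have test := integral_radial_test hd hw dχ cχ ha hb0.le hbR χconst χzero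
    -- Moves the derivative from P to χ; the boundary terms vanish since χ(b) = 0 and P(0) = 0.
    have parts := intervalIntegral.integral_mul_deriv_eq_deriv_mul (u := χ) (v := P) (a := 0)
      (b := b) (fun r _ => dχ r) (fun r hr => dP r (hIu hr))
      (hgcont.intervalIntegrable _ _) (cl'.mono hIu).intervalIntegrable
    have hP0 : P 0 = 0 := intervalIntegral.integral_same
    rw [χzero b le_rfl, hP0, zero_mul, mul_zero, sub_zero, zero_sub] at parts
    have i1 : IntervalIntegrable (fun r => g r * (r ^ (d - 1) * q r)) volume 0 b :=
      (hgcont.continuousOn.mul ((cpow.continuousOn.mul cq).mono hIu)).intervalIntegrable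
    have i2 : IntervalIntegrable (fun r => χ r * (r ^ (d - 1) * l r)) volume 0 b :=
      (cχ.continuous.continuousOn.mul (cl'.mono hIu)).intervalIntegrable
    have i3 : IntervalIntegrable (fun r => g r * P r) volume 0 b :=
      (hgcont.continuousOn.mul (cP.mono hIu)).intervalIntegrable
    have test' : (∫ r in (0 : ℝ)..b, g r * (r ^ (d - 1) * q r)) +
        ∫ r in (0 : ℝ)..b, χ r * (r ^ (d - 1) * l r) = 0 := by
      rw [← intervalIntegral.integral_add i1 i2, ← test]
      congr 1; ext r; ring
    rw [← intervalIntegral.integral_eq_integral_of_support_subset (a := 0) (b := b)]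
    · simp only [smul_eq_mul, mul_sub]
      rw [intervalIntegral.integral_sub i1 i3]
      linarith
    · intro r hr
      have hgr : g r ≠ 0 := fun h => hr (by simp [h])
      constructor
      · by_contra hcon
        exact hgr (hga r ((not_lt.1 hcon).trans ha.le))
      · by_contra hcon
        exact hgr (hgb r (not_le.1 hcon).le)
  -- Both sides are continuous, so almost everywhere becomes everywhere.
  have := Measure.eqOn_open_of_ae_eq (μ := volume) (f := fun r => r ^ (d - 1) * q r - P r)
    (g := fun _ => (0 : ℝ)) ((ae_restrict_iff' measurableSet_Ioo).2 key) isOpen_Ioo (cf.mono hsub)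
    continuousOn_const hr
  exact sub_eq_zero.1 this

end HeatWalk

/-! ### Spherical means of solutions of the heat equation. -/

namespace HeatWalk

variable {d : ℕ} {T : ℝ} {D : Set (E d)} {f : ℝ → E d → ℝ} {f₀ : E d → ℝ} {u : ℝ → E d → ℝ}

/-- Rescaled spherical means of a solution of the heat equation are radially caloric. -/
lemma IsSolution.isRadialCaloric (hd : 0 < d) (hu : IsSolution T D f f₀ u)
    {t a R r₀ : ℝ} {x : E d} (ht : t ≤ T) (ha : 0 < a) (hat : a ≤ t) (hball : Metric.ball x R ⊆ D)
    (hr₀ : Real.sqrt a * r₀ < R) :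
    IsRadialCaloric d r₀
      (fun s r => ∫ v, u (t - a * s) (x + (Real.sqrt a * r) • (v : E d)) ∂surface d)
      (fun s r => a * ∫ v, derivWithin (fun s => u s (x + (Real.sqrt a * r) • (v : E d)))
        (Icc 0 T) (t - a * s) ∂surface d)
      (fun s r => Real.sqrt a * ∫ v, fderiv ℝ (u (t - a * s)) (x + (Real.sqrt a * r) • (v : E d))
        (v : E d) ∂surface d) := by
  have hsa : 0 < Real.sqrt a := Real.sqrt_pos.2 ha
  have htime : ∀ s ∈ Icc (0 : ℝ) 1, t - a * s ∈ Icc 0 T := fun s hs =>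
    ⟨by nlinarith [hs.2], by nlinarith [hs.1]⟩
  have htime' : ∀ s ∈ Ioo (0 : ℝ) 1, t - a * s ∈ Ioo 0 T := fun s hs =>
    ⟨by nlinarith [hs.2], by nlinarith [hs.1]⟩
  have hrad : ∀ r ∈ Icc 0 r₀, Real.sqrt a * r ∈ Ioo (-R) R := fun r hr => by
    have h1 : 0 ≤ Real.sqrt a * r := mul_nonneg hsa.le hr.1
    have h2 : Real.sqrt a * r ≤ Real.sqrt a * r₀ := mul_le_mul_of_nonneg_left hr.2 hsa.le
    exact ⟨by linarith, by linarith⟩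
  have hspace : ∀ r ∈ Icc 0 r₀, ∀ v : Metric.sphere (0 : E d) 1,
      x + (Real.sqrt a * r) • (v : E d) ∈ D := fun r hr v =>
    hball (add_smul_mem_ball v (hrad r hr))
  have joint : ∀ {g : ℝ × E d → ℝ}, ContinuousOn g (Icc 0 T ×ˢ D) →
      ContinuousOn (fun p : (ℝ × ℝ) × Metric.sphere (0 : E d) 1 =>
        g (t - a * p.1.1, x + (Real.sqrt a * p.1.2) • (p.2 : E d)))
        ((Icc 0 1 ×ˢ Icc 0 r₀) ×ˢ univ) := fun hg =>
    hg.comp (f := fun p : (ℝ × ℝ) × Metric.sphere (0 : E d) 1 =>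
        (t - a * p.1.1, x + (Real.sqrt a * p.1.2) • (p.2 : E d))) (by fun_prop)
      fun p hp => ⟨htime _ hp.1.1, hspace _ hp.1.2 _⟩
  have hcl : IsLocallyClosed (Icc (0 : ℝ) 1 ×ˢ Icc (0 : ℝ) r₀) :=
    (isClosed_Icc.prod isClosed_Icc).isLocallyClosed
  have j0 := joint hu.isC12.continuousOn
  have j1 := joint hu.isC12.continuousOn_deriv_time
  have hC2 : ∀ s ∈ Icc (0 : ℝ) 1, ContDiffOn ℝ 2 (u (t - a * s)) (Metric.ball x R) := fun s hs =>
    (hu.isC12.contDiffOn_space _ (htime s hs)).mono hball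
  refine ⟨?_, ?_, ?_, ?_, ?_⟩
  · exact continuousOn_integral_sphere hcl (surface d)
      (F := fun (p : ℝ × ℝ) v => u (t - a * p.1) (x + (Real.sqrt a * p.2) • (v : E d))) j0
  · exact continuousOn_const.mul (continuousOn_integral_sphere hcl (surface d)
      (F := fun (p : ℝ × ℝ) v => derivWithin (fun s => u s (x + (Real.sqrt a * p.2) • (v : E d)))
        (Icc 0 T) (t - a * p.1)) j1)
  · intro s hs r hr
    obtain ⟨b, hb1, hb2⟩ := exists_between hs.1
    obtain ⟨c, hc1, hc2⟩ := exists_between hs.2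
    have hbc : Icc b c ⊆ Icc 0 1 := Icc_subset_Icc hb1.le hc2.le
    have slice : ∀ {G : (ℝ × ℝ) × Metric.sphere (0 : E d) 1 → ℝ},
        ContinuousOn G ((Icc 0 1 ×ˢ Icc 0 r₀) ×ˢ univ) → ∀ y ∈ Icc (0 : ℝ) 1,
        Continuous fun v => G ((y, r), v) := fun hG y hy =>
      hG.comp_continuous (by fun_prop) fun v => ⟨⟨hy, hr⟩, mem_univ _⟩
    obtain ⟨C, hC⟩ := ((isCompact_Icc.prod isCompact_Icc).prod isCompact_univ
      ).exists_bound_of_continuousOn j1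
    have key := (hasDerivAt_integral_of_dominated_loc_of_deriv_le (bound := fun _ => a * C)
      (μ := surface d) (x₀ := s)
      (F := fun (s : ℝ) (v : Metric.sphere (0 : E d) 1) =>
        u (t - a * s) (x + (Real.sqrt a * r) • (v : E d)))
      (F' := fun (s : ℝ) (v : Metric.sphere (0 : E d) 1) =>
        -(a * derivWithin (fun s => u s (x + (Real.sqrt a * r) • (v : E d))) (Icc 0 T) (t - a * s)))
      (Icc_mem_nhds hb2 hc1) ?_ ?_ ?_ ?_ ?_ ?_).2
    · rwa [integral_neg, integral_const_mul] at key
    · filter_upwards [Icc_mem_nhds hb2 hc1] with y hy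
      exact (slice j0 y (hbc hy)).aestronglyMeasurable
    · exact (slice j0 s (Ioo_subset_Icc_self hs)).integrable_of_hasCompactSupport
        (HasCompactSupport.of_compactSpace _)
    · exact ((slice j1 s (Ioo_subset_Icc_self hs)).const_smul a).neg.aestronglyMeasurable
    · refine Eventually.of_forall fun v y hy => ?_
      rw [norm_neg, norm_mul, Real.norm_of_nonneg ha.le]
      exact mul_le_mul_of_nonneg_left (hC ((y, r), v) ⟨⟨hbc hy, hr⟩, mem_univ _⟩) ha.le
    · exact integrable_const _
    · refine Eventually.of_forall fun v y hy => ?_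
      have hy' : y ∈ Ioo (0 : ℝ) 1 := ⟨hb1.trans_le hy.1, hy.2.trans_lt hc2⟩
      -- For 0 < y < 1 the time t - ay is interior to [0,T], so the one-sided derivative is a
      -- genuine derivative.
      have h1 := (hu.isC12.differentiable_time _ (htime y (hbc hy)) _
        (hspace r hr v)).hasDerivWithinAt.hasDerivAt
          (Icc_mem_nhds (htime' y hy').1 (htime' y hy').2)
      have h2 : HasDerivAt (fun y : ℝ => t - a * y) (-a) y := by
        simpa using ((hasDerivAt_id y).const_mul a).const_sub t
      have h3 := HasDerivAt.comp (h := fun y => t - a * y) y h1 h2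
      exact h3.congr_deriv (by ring)
  · intro s hs r hr
    have h1 := hasDerivAt_sphereMean (hC2 s (Ioo_subset_Icc_self hs)) (hrad r (Ioo_subset_Icc_self hr))
    have h2 : HasDerivAt (fun r => Real.sqrt a * r) (Real.sqrt a) r := by
      simpa using (hasDerivAt_id r).const_mul (Real.sqrt a)
    exact (h1.comp r h2).congr_deriv (by ring)
  · intro s hs r hr
    have hr' := hrad r (Ioo_subset_Icc_self hr)
    -- The divergence theorem at radius √a r, rescaled by τ ↦ √a τ, with Δu replaced by ∂_t u. The
    -- powers of √a balance because space scales by √a and time by a.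
    have h1 := sphere_flux_eq hd (hC2 s (Ioo_subset_Icc_self hs))
      (r := Real.sqrt a * r) ⟨mul_pos hsa hr.1, hr'.2⟩
    have h2 := intervalIntegral.integral_comp_mul_left (a := 0) (b := r) (c := Real.sqrt a)
      (fun τ => τ ^ (d - 1) * ∫ v, Laplacian.laplacian (u (t - a * s)) (x + τ • (v : E d)) ∂surface d)
      hsa.ne'
    rw [mul_zero, ← h1] at h2
    have h3 : ∫ τ in (0 : ℝ)..r, (Real.sqrt a * τ) ^ (d - 1) *
        ∫ v, Laplacian.laplacian (u (t - a * s)) (x + (Real.sqrt a * τ) • (v : E d)) ∂surface d =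
        Real.sqrt a ^ (d - 1) * ∫ τ in (0 : ℝ)..r, τ ^ (d - 1) *
          ∫ v, derivWithin (fun s => u s (x + (Real.sqrt a * τ) • (v : E d)))
            (Icc 0 T) (t - a * s) ∂surface d := by
      rw [← intervalIntegral.integral_const_mul]
      refine intervalIntegral.integral_congr fun τ hτ => ?_
      rw [uIcc_of_le hr.1.le] at hτ
      simp only [mul_pow, mul_assoc]
      congr 3
      ext v
      exact (hu.heat_eq _ (htime s (Ioo_subset_Icc_self hs)) _
        (hspace τ ⟨hτ.1, hτ.2.trans hr.2.le⟩ v)).symm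
    rw [h3, smul_eq_mul, mul_pow] at h2
    have hp : Real.sqrt a ^ (d - 1) ≠ 0 := (pow_pos hsa _).ne'
    have h4 : ∫ τ in (0 : ℝ)..r, τ ^ (d - 1) * (a *
          ∫ v, derivWithin (fun s => u s (x + (Real.sqrt a * τ) • (v : E d)))
            (Icc 0 T) (t - a * s) ∂surface d) = a * ∫ τ in (0 : ℝ)..r, τ ^ (d - 1) *
          ∫ v, derivWithin (fun s => u s (x + (Real.sqrt a * τ) • (v : E d)))
            (Icc 0 T) (t - a * s) ∂surface d := by
      rw [← intervalIntegral.integral_const_mul]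
      congr 1; ext τ; ring
    rw [h4]
    have h5 : ∀ {I Q : ℝ}, Real.sqrt a ^ (d - 1) * I =
        (Real.sqrt a)⁻¹ * (Real.sqrt a ^ (d - 1) * r ^ (d - 1) * Q) →
        r ^ (d - 1) * (Real.sqrt a * Q) = a * I := by
      intro I Q hIQ
      have h6 : I = (Real.sqrt a)⁻¹ * (r ^ (d - 1) * Q) := by
        apply mul_left_cancel₀ hp; rw [hIQ]; ring
      rw [h6]
      have h7 : a * (Real.sqrt a)⁻¹ = Real.sqrt a := by
        rw [← div_eq_mul_inv, Real.div_sqrt]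
      rw [← mul_assoc a, h7]; ring
    exact h5 h2

end HeatWalk

/-! ### The law of the random radius. -/

namespace HeatWalk

/-- The joint law of one pair `(U_n, G_n)`. -/
noncomputable abbrev seedLaw (d : ℕ) : Measure ((Fin (d / 2 + 1) → ℝ) × ℝ) :=
  (volume.restrict (Icc 0 1)).prod (gaussianReal 0 1)

lemma restrict_cube_eq_pi (k : ℕ) : (volume : Measure (Fin k → ℝ)).restrict (Icc 0 1) =
    Measure.pi fun _ => volume.restrict (Icc (0 : ℝ) 1) := by
  rw [← Measure.restrict_pi_pi, pi_univ_Icc]; rfl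

instance (k : ℕ) : IsProbabilityMeasure ((volume : Measure (Fin k → ℝ)).restrict (Icc 0 1)) := by
  have : IsProbabilityMeasure ((volume : Measure ℝ).restrict (Icc (0 : ℝ) 1)) := ⟨by simp⟩
  rw [restrict_cube_eq_pi]
  infer_instance

lemma measurable_radius (d : ℕ) :
    Measurable fun p : (Fin (d / 2 + 1) → ℝ) × ℝ => radius d p.1 p.2 := by
  unfold radius
  fun_prop

lemma gaussian_exponent_nonneg {d : ℕ} (hd : 0 < d) :
    (0 : ℝ) ≤ 1 - 2 / (d : ℝ) * ((d / 2 : ℕ) : ℝ) := by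
  have h1 : ((d / 2 : ℕ) : ℝ) ≤ d / 2 := Nat.cast_div_le
  have hd' : (0 : ℝ) < d := Nat.cast_pos.2 hd
  have : 2 / (d : ℝ) * ((d / 2 : ℕ) : ℝ) ≤ 2 / d * (d / 2) := by gcongr
  have e : 2 / (d : ℝ) * (d / 2) = 1 := by field_simp
  linarith

lemma radius_mem_Icc {d : ℕ} (hd : 0 < d) {U : Fin (d / 2 + 1) → ℝ} (hU : U ∈ Icc 0 1) (G : ℝ) :
    radius d U G ∈ Icc (0 : ℝ) 1 := by
  have h0 : 0 ≤ ∏ i, U i := Finset.prod_nonneg fun i _ => hU.1 i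
  have h1 : ∏ i, U i ≤ 1 := Finset.prod_le_one (fun i _ => hU.1 i) fun i _ => hU.2 i
  have hd' : (0 : ℝ) < d := Nat.cast_pos.2 hd
  have hc := gaussian_exponent_nonneg hd
  refine ⟨mul_nonneg (Real.rpow_nonneg h0 _) (Real.exp_pos _).le, ?_⟩
  refine mul_le_one₀ (Real.rpow_le_one h0 h1 (by positivity)) (Real.exp_pos _).le ?_
  rw [Real.exp_le_one_iff]
  have := mul_nonneg hc (sq_nonneg G)
  linarith

lemma ae_radius_mem_Icc {d : ℕ} (hd : 0 < d) :
    ∀ᵐ p ∂seedLaw d, radius d p.1 p.2 ∈ Icc (0 : ℝ) 1 := by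
  have h : ∀ᵐ U ∂(volume : Measure (Fin (d / 2 + 1) → ℝ)).restrict (Icc 0 1), U ∈ Icc 0 1 :=
    ae_restrict_mem measurableSet_Icc
  have := Measure.quasiMeasurePreserving_fst (μ := (volume : Measure (Fin (d / 2 + 1) → ℝ)).restrict
    (Icc 0 1)) (ν := gaussianReal 0 1) |>.ae h
  filter_upwards [this] with p hp using radius_mem_Icc hd hp _

lemma integral_cube_prod_rpow {d : ℕ} (hd : 0 < d) (p : ℕ) :
    ∫ U : Fin (d / 2 + 1) → ℝ in Icc 0 1, ((∏ i, U i) ^ (2 / (d : ℝ))) ^ p =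
      (1 / (1 + 2 * p / d : ℝ)) ^ (d / 2 + 1) := by
  have hd' : (0 : ℝ) < d := Nat.cast_pos.2 hd
  have h1 : ∫ U : Fin (d / 2 + 1) → ℝ in Icc 0 1, ((∏ i, U i) ^ (2 / (d : ℝ))) ^ p =
      ∫ U : Fin (d / 2 + 1) → ℝ in Icc 0 1, ∏ i, U i ^ (2 * p / d : ℝ) := by
    refine setIntegral_congr_fun measurableSet_Icc fun U hU => ?_
    have h0 : 0 ≤ ∏ i, U i := Finset.prod_nonneg fun i _ => hU.1 i
    rw [← Real.rpow_natCast, ← Real.rpow_mul h0, Real.finsetProd_rpow _ _ fun i _ => hU.1 i]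
    congr 1; ring
  have h2 : ∫ x in Icc (0 : ℝ) 1, x ^ (2 * p / d : ℝ) = 1 / (1 + 2 * p / d : ℝ) := by
    have : (0 : ℝ) ≤ 2 * p / d := by positivity
    rw [integral_Icc_eq_integral_Ioc, ← intervalIntegral.integral_of_le zero_le_one,
      integral_rpow (Or.inl (by linarith)), Real.one_rpow, Real.zero_rpow (by linarith)]
    ring
  rw [h1, restrict_cube_eq_pi,
    integral_fintype_prod_eq_prod (fun (_ : Fin (d / 2 + 1)) (x : ℝ) => x ^ (2 * p / d : ℝ))]
  simp [h2]

lemma integral_exp_neg_sq_gaussian {c : ℝ} (hc : 0 ≤ c) (p : ℕ) :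
    ∫ G, Real.exp (-c * G ^ 2) ^ p ∂gaussianReal 0 1 = (1 / (1 + 2 * c * p)) ^ (1 / 2 : ℝ) := by
  have hb : (0 : ℝ) < 1 / 2 + c * p := by positivity
  rw [integral_gaussianReal_eq_integral_smul one_ne_zero]
  have h1 : ∀ x : ℝ, gaussianPDFReal 0 1 x • Real.exp (-c * x ^ 2) ^ p =
      (Real.sqrt (2 * Real.pi))⁻¹ * Real.exp (-(1 / 2 + c * p) * x ^ 2) := by
    intro x
    rw [gaussianPDFReal, ← Real.exp_nat_mul, smul_eq_mul, mul_assoc, ← Real.exp_add]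
    simp only [NNReal.coe_one, mul_one, sub_zero]
    congr 2; ring
  simp only [h1]
  rw [integral_const_mul, integral_gaussian, ← Real.sqrt_eq_rpow, ← Real.sqrt_inv,
    ← Real.sqrt_mul (by positivity)]
  congr 1
  have := Real.pi_pos
  field_simp

/-- The moments of `R_n`. -/
lemma integral_radius_pow {d : ℕ} (hd : 0 < d) (p : ℕ) :
    ∫ x, radius d x.1 x.2 ^ p ∂seedLaw d = (1 / (1 + 2 * p / d : ℝ)) ^ (d / 2 + 1 : ℝ) := by
  have hd' : (0 : ℝ) < d := Nat.cast_pos.2 hd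
  simp only [radius, mul_pow]
  rw [integral_prod_mul (fun U : Fin (d / 2 + 1) → ℝ => ((∏ i, U i) ^ (2 / (d : ℝ))) ^ p)
    (fun G : ℝ => Real.exp (-(1 - 2 / (d : ℝ) * ((d / 2 : ℕ) : ℝ)) * G ^ 2) ^ p),
    integral_cube_prod_rpow hd, integral_exp_neg_sq_gaussian (gaussian_exponent_nonneg hd)]
  -- For even d the Gaussian exponent is 0 and the uniforms alone give the power d/2+1. For odd d it
  -- equals 1/d, so the Gaussian moment has the same base as the uniform ones and supplies the
  -- missing half power.
  rcases Nat.even_or_odd' d with ⟨k, rfl | rfl⟩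
  · have hk : (k : ℝ) ≠ 0 := by
      rintro h; simp [h] at hd'
    have e1 : 2 * k / 2 = k := by omega
    rw [e1]
    have e2 : (1 : ℝ) - 2 / ((2 * k : ℕ) : ℝ) * k = 0 := by push_cast; field_simp; ring
    rw [e2, ← Real.rpow_natCast]
    simp
  · have e1 : (2 * k + 1) / 2 = k := by omega
    rw [e1]
    have e2 : 2 * ((1 : ℝ) - 2 / ((2 * k + 1 : ℕ) : ℝ) * k) * p = 2 * p / ((2 * k + 1 : ℕ) : ℝ) := by
      push_cast; field_simp; ring
    rw [e2, ← Real.rpow_natCast, ← Real.rpow_add (by positivity)]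
    congr 1; push_cast; ring

/-- Both moment sequences are explicit powers with exponent d/2+1, and (1+2p/d) · d/2 = p + d/2. -/
lemma integral_radius_pow_mul {d : ℕ} (hd : 0 < d) (p : ℕ) :
    (∫ x, radius d x.1 x.2 ^ p ∂seedLaw d) * ∫ s in Ioo (0 : ℝ) 1, heatWeight d s =
      ∫ s in Ioo (0 : ℝ) 1, s ^ p * heatWeight d s := by
  have h0 := integral_pow_mul_heatWeight hd 0
  simp only [pow_zero, one_mul, Nat.cast_zero, zero_add] at h0
  have hd' : (0 : ℝ) < d := Nat.cast_pos.2 hd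
  rw [h0, integral_pow_mul_heatWeight hd, integral_radius_pow hd]
  have : (1 / (1 + 2 * p / d : ℝ)) ^ (d / 2 + 1 : ℝ) * (1 / (d / 2 : ℝ)) ^ (d / 2 + 1 : ℝ) =
      (1 / (p + d / 2 : ℝ)) ^ (d / 2 + 1 : ℝ) := by
    rw [← Real.mul_rpow (by positivity) (by positivity)]
    congr 1
    field_simp
    ring
  rw [← this]; ring

lemma integrable_radius_comp {d : ℕ} (hd : 0 < d) {g : ℝ → ℝ} (hg : ContinuousOn g (Icc 0 1)) :
    Integrable (fun x : (Fin (d / 2 + 1) → ℝ) × ℝ => g (radius d x.1 x.2)) (seedLaw d) := by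
  obtain ⟨C, hC⟩ := isCompact_Icc.exists_bound_of_continuousOn hg
  -- Outside [0,1] nothing is known about g; the indicator is measurable and agrees with g at the
  -- radius almost surely.
  have hgm : Measurable ((Icc (0 : ℝ) 1).indicator g) :=
    Set.piecewise_eq_indicator (f := g) (s := Icc (0 : ℝ) 1) ▸
      hg.measurable_piecewise continuousOn_const measurableSet_Icc
  have h1 : Integrable (fun x : (Fin (d / 2 + 1) → ℝ) × ℝ =>
      (Icc (0 : ℝ) 1).indicator g (radius d x.1 x.2)) (seedLaw d) := by
    refine Integrable.of_bound (hgm.comp (measurable_radius d)).aestronglyMeasurable C ?_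
    filter_upwards [ae_radius_mem_Icc hd] with x hx
    rw [indicator_of_mem hx]; exact hC _ hx
  refine h1.congr ?_
  filter_upwards [ae_radius_mem_Icc hd] with x hx
  rw [indicator_of_mem hx]

lemma integrableOn_mul_heatWeight {d : ℕ} (hd : 0 < d) {g : ℝ → ℝ} (hg : ContinuousOn g (Icc 0 1)) :
    IntegrableOn (fun s => g s * heatWeight d s) (Ioo 0 1) := by
  rw [← intervalIntegrable_iff_integrableOn_Ioo_of_le zero_le_one]
  exact (intervalIntegrable_heatWeight hd).continuousOn_mul (by rwa [uIcc_of_le zero_le_one])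

/-- The law of `R_n` is the normalized `heatWeight`. -/
theorem integral_radius_comp_mul {d : ℕ} (hd : 0 < d) {g : ℝ → ℝ} (hg : ContinuousOn g (Icc 0 1)) :
    (∫ x, g (radius d x.1 x.2) ∂seedLaw d) * ∫ s in Ioo (0 : ℝ) 1, heatWeight d s =
      ∫ s in Ioo (0 : ℝ) 1, g s * heatWeight d s := by
  set W := ∫ s in Ioo (0 : ℝ) 1, heatWeight d s
  have hW : 0 < W := integral_heatWeight_pos hd
  have hpoly : ∀ q : Polynomial ℝ, (∫ x, q.eval (radius d x.1 x.2) ∂seedLaw d) * W =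
      ∫ s in Ioo (0 : ℝ) 1, q.eval s * heatWeight d s := by
    intro q
    induction q using Polynomial.induction_on' with
    | add q₁ q₂ h₁ h₂ =>
      simp only [Polynomial.eval_add, add_mul]
      rw [integral_add (integrable_radius_comp hd q₁.continuous.continuousOn)
        (integrable_radius_comp hd q₂.continuous.continuousOn),
        integral_add (integrableOn_mul_heatWeight hd q₁.continuous.continuousOn)
        (integrableOn_mul_heatWeight hd q₂.continuous.continuousOn), add_mul, h₁, h₂]
    | monomial n a =>
      simp only [Polynomial.eval_monomial, mul_assoc]
      rw [integral_const_mul, integral_const_mul, ← integral_radius_pow_mul hd n, mul_assoc]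
  refine eq_of_abs_sub_le_all fun ε hε => ?_
  -- The tolerance makes each of the two approximation errors, once multiplied by W, at most ε/2.
  obtain ⟨q, hq⟩ := exists_polynomial_near_of_continuousOn 0 1 g hg (ε / (2 * W)) (by positivity)
  have hqc : ContinuousOn (fun s => q.eval s) (Icc 0 1) := q.continuous.continuousOn
  have b1 : |(∫ x, g (radius d x.1 x.2) ∂seedLaw d) - ∫ x, q.eval (radius d x.1 x.2) ∂seedLaw d| ≤
      ε / (2 * W) := by
    rw [← integral_sub (integrable_radius_comp hd hg) (integrable_radius_comp hd hqc)]
    have := norm_integral_le_of_norm_le_const (μ := seedLaw d) (C := ε / (2 * W))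
      (f := fun x => g (radius d x.1 x.2) - q.eval (radius d x.1 x.2)) (by
        filter_upwards [ae_radius_mem_Icc hd] with x hx
        rw [Real.norm_eq_abs, abs_sub_comm]; exact (hq _ hx).le)
    simpa using this
  have b2 : |(∫ s in Ioo (0 : ℝ) 1, g s * heatWeight d s) -
      ∫ s in Ioo (0 : ℝ) 1, q.eval s * heatWeight d s| ≤ ε / (2 * W) * W := by
    rw [← integral_sub (integrableOn_mul_heatWeight hd hg) (integrableOn_mul_heatWeight hd hqc),
      ← integral_const_mul, ← Real.norm_eq_abs]
    refine norm_integral_le_of_norm_le ((integrableOn_heatWeight hd).const_mul _) ?_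
    refine (ae_restrict_iff' measurableSet_Ioo).2 (Eventually.of_forall fun s hs => ?_)
    have hw := heatWeight_nonneg d hs.1.le
    rw [← sub_mul, norm_mul, Real.norm_of_nonneg hw, Real.norm_eq_abs, abs_sub_comm]
    exact mul_le_mul_of_nonneg_right (hq _ (Ioo_subset_Icc_self hs)).le hw
  rw [← hpoly q] at b2
  set A := ∫ x, g (radius d x.1 x.2) ∂seedLaw d
  set B := ∫ x, q.eval (radius d x.1 x.2) ∂seedLaw d
  have e : ε / (2 * W) * W = ε / 2 := by field_simp
  rw [e] at b2
  have b3 : |A * W - B * W| ≤ ε / 2 := by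
    rw [← sub_mul, abs_mul, abs_of_pos hW, ← e]
    exact mul_le_mul_of_nonneg_right b1 hW.le
  rw [abs_sub_comm] at b2
  calc _ = |(A * W - B * W) + (B * W - ∫ s in Ioo (0 : ℝ) 1, g s * heatWeight d s)| := by
        congr 1; ring
    _ ≤ _ := (abs_add_le _ _).trans (by linarith)

/-- Used to show that the first step strictly decreases time when α is positive. -/
lemma ae_radius_pos {d : ℕ} : ∀ᵐ p ∂seedLaw d, 0 < radius d p.1 p.2 := by
  have h : ∀ᵐ U ∂(volume : Measure (Fin (d / 2 + 1) → ℝ)).restrict (Icc 0 1), ∀ i, 0 < U i := by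
    rw [ae_all_iff]
    intro i
    have h1 : ∀ᵐ x ∂(volume.restrict (Icc (0 : ℝ) 1)), 0 < x := by
      rw [Measure.restrict_congr_set Ioc_ae_eq_Icc.symm]
      filter_upwards [ae_restrict_mem measurableSet_Ioc] with x hx using hx.1
    rw [restrict_cube_eq_pi]
    exact (Measure.quasiMeasurePreserving_eval _ i).ae h1
  have := Measure.quasiMeasurePreserving_fst (μ := (volume : Measure (Fin (d / 2 + 1) → ℝ)).restrict
    (Icc 0 1)) (ν := gaussianReal 0 1) |>.ae h
  filter_upwards [this] with p hp
  exact mul_pos (Real.rpow_pos_of_pos (Finset.prod_pos fun i _ => hp i) _) (Real.exp_pos _)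

end HeatWalk

/-! ### Geometry of one step. -/

namespace HeatWalk

variable {d : ℕ} {T : ℝ} {D : Set (E d)} {f : ℝ → E d → ℝ} {f₀ : E d → ℝ} {u : ℝ → E d → ℝ}

lemma isProbabilityMeasure_sphereUniform (hd : 0 < d) : IsProbabilityMeasure (sphereUniform d) := by
  have : Nonempty (Fin d) := ⟨⟨0, hd⟩⟩
  refine ⟨?_⟩
  rw [sphereUniform, Measure.smul_apply, smul_eq_mul]
  refine ENNReal.inv_mul_cancel ?_ (measure_ne_top _ _)
  exact fun h => Measure.toSphere_ne_zero _ (Measure.measure_univ_eq_zero.1 h)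

/-- The joint law of `((U_n, G_n), V_n)`. -/
noncomputable abbrev noiseLaw (d : ℕ) :
    Measure (((Fin (d / 2 + 1) → ℝ) × ℝ) × Metric.sphere (0 : E d) 1) :=
  (seedLaw d).prod (sphereUniform d)

/-- One step of the walk from `p`, on the heat ball of parameter `a`. -/
noncomputable def scaledStep (a : ℝ) (p : ℝ × E d)
    (z : ((Fin (d / 2 + 1) → ℝ) × ℝ) × Metric.sphere (0 : E d) 1) : ℝ × E d :=
  (p.1 - a * radius d z.1.1 z.1.2,
    p.2 + (2 * Real.sqrt a * psi d (radius d z.1.1 z.1.2)) • (z.2 : E d))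

lemma measurable_psi (d : ℕ) : Measurable (psi d) := by
  unfold psi
  fun_prop

lemma measurable_scaledStep {X : Type*} [MeasurableSpace X] {a : X → ℝ} {p : X → ℝ × E d}
    {z : X → ((Fin (d / 2 + 1) → ℝ) × ℝ) × Metric.sphere (0 : E d) 1}
    (ha : Measurable a) (hp : Measurable p) (hz : Measurable z) :
    Measurable fun x => scaledStep (a x) (p x) (z x) := by
  have h1 : Measurable fun x => radius d (z x).1.1 (z x).1.2 := (measurable_radius d).comp hz.fst
  have h2 : Measurable fun x => psi d (radius d (z x).1.1 (z x).1.2) := (measurable_psi d).comp h1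
  have h3 : Measurable fun x => ((z x).2 : E d) := measurable_subtype_coe.comp hz.snd
  unfold scaledStep
  exact (hp.fst.sub (ha.mul h1)).prodMk
    (hp.snd.add (((ha.sqrt.const_mul 2).mul h2).smul h3))

/-- The ball is connected and misses the frontier, so it cannot meet both the interior of D and the
complement of its closure. -/
lemma ball_infDist_frontier_subset {y : E d} (hy : y ∈ D) :
    Metric.ball y (Metric.infDist y (frontier D)) ⊆ D := by
  intro z hz
  by_contra hzD
  have hpre : IsPreconnected (Metric.ball y (Metric.infDist y (frontier D))) :=
    (convex_ball _ _).isPreconnected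
  have hy' : y ∈ Metric.ball y (Metric.infDist y (frontier D)) :=
    Metric.mem_ball_self (dist_nonneg.trans_lt hz)
  have hfr : ∀ w ∈ Metric.ball y (Metric.infDist y (frontier D)), w ∈ closure D → w ∈ interior D := by
    intro w hw hwc
    by_contra hwi
    have := Metric.infDist_le_dist_of_mem (x := y) (show w ∈ frontier D from ⟨hwc, hwi⟩)
    rw [Metric.mem_ball, dist_comm] at hw
    linarith
  obtain ⟨w, -, hw1, hw2⟩ := hpre (interior D) (closure D)ᶜ isOpen_interior
    isClosed_closure.isOpen_compl
    (fun w hw => (em (w ∈ closure D)).imp (hfr w hw) id) ⟨y, hy', hfr y hy' (subset_closure hy)⟩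
    ⟨z, hz, fun h => hzD (interior_subset (hfr z hz h))⟩
  exact hw2 (interior_subset_closure hw1)

/-- The closed ball is needed because the heat ball of parameter α may touch the frontier. -/
lemma closedBall_infDist_frontier_subset (hD : IsOpen D) {y : E d} (hy : y ∈ closure D) :
    Metric.closedBall y (Metric.infDist y (frontier D)) ⊆ closure D := by
  rcases (Metric.infDist_nonneg (x := y) (s := frontier D)).eq_or_lt with h | h
  · rw [← h, Metric.closedBall_zero]
    exact singleton_subset_iff.2 hy
  · have hyD : y ∈ D := by
      by_contra hcon
      have : y ∈ frontier D := ⟨hy, by rwa [hD.interior_eq]⟩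
      rw [Metric.infDist_zero_of_mem this] at h
      exact lt_irrefl _ h
    rw [← closure_ball y h.ne']
    exact closure_mono (ball_infDist_frontier_subset hyD)

lemma alpha_nonneg {s : ℝ} (hs : 0 ≤ s) (y : E d) : 0 ≤ alpha D s y := by
  refine le_min hs ?_
  have := Real.exp_pos 1
  positivity

lemma alpha_le (s : ℝ) (y : E d) : alpha D s y ≤ s := min_le_left _ _

lemma continuous_alpha : Continuous fun p : ℝ × E d => alpha D p.1 p.2 := by
  unfold alpha
  have : Continuous fun p : ℝ × E d => Metric.infDist p.2 (frontier D) :=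
    (Metric.continuous_infDist_pt _).comp continuous_snd
  fun_prop

/-- The left side bounds the width of the heat ball of parameter a; at a = e/(2d) δ² it equals δ,
which explains the constant in `alpha`. -/
lemma sqrt_mul_maxRadius_le (hd : 0 < d) {s a : ℝ} {y : E d} (ha : 0 ≤ a) (haα : a ≤ alpha D s y) :
    Real.sqrt a * (2 * Real.sqrt (d / (2 * Real.exp 1))) ≤ Metric.infDist y (frontier D) := by
  have hd' : (0 : ℝ) < d := Nat.cast_pos.2 hd
  have he := Real.exp_pos 1
  have h1 : a ≤ Real.exp 1 / (2 * d) * Metric.infDist y (frontier D) ^ 2 :=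
    haα.trans (min_le_right _ _)
  refine abs_le_of_sq_le_sq' ?_ Metric.infDist_nonneg |>.2
  rw [mul_pow, mul_pow, Real.sq_sqrt ha, Real.sq_sqrt (by positivity)]
  calc a * (2 ^ 2 * (d / (2 * Real.exp 1))) ≤
      (Real.exp 1 / (2 * d) * Metric.infDist y (frontier D) ^ 2) * (2 ^ 2 * (d / (2 * Real.exp 1))) := by
        gcongr
    _ = _ := by field_simp

lemma psi_le {r : ℝ} (hr : r ∈ Icc (0 : ℝ) 1) : psi d r ≤ Real.sqrt (d / (2 * Real.exp 1)) :=
  Real.le_sqrt_of_sq_le (psi_sq_le d hr)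

/-- Allows any parameter up to α, because the mean value property is first proved below α and then
extended by a limit. -/
lemma step_mem (hd : 0 < d) (hD : IsOpen D) {s a : ℝ} {y : E d} (hy : y ∈ closure D)
    (ha : 0 ≤ a) (haα : a ≤ alpha D s y) {r : ℝ} (hr : r ∈ Icc (0 : ℝ) 1)
    (v : Metric.sphere (0 : E d) 1) :
    (s - a * r, y + (2 * Real.sqrt a * psi d r) • (v : E d)) ∈ Icc 0 s ×ˢ closure D := by
  have h1 : a ≤ s := haα.trans (alpha_le s y)
  refine ⟨⟨?_, ?_⟩, ?_⟩
  · have : a * r ≤ a * 1 := mul_le_mul_of_nonneg_left hr.2 ha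
    simp only; linarith
  · have := mul_nonneg ha hr.1
    simp only; linarith
  · refine closedBall_infDist_frontier_subset hD hy ?_
    have hψ := psi_nonneg d r
    rw [Metric.mem_closedBall, dist_self_add_left, norm_smul, norm_eq_of_mem_sphere, mul_one,
      Real.norm_of_nonneg (by positivity)]
    refine le_trans ?_ (sqrt_mul_maxRadius_le hd ha haα)
    have := psi_le (d := d) hr
    calc 2 * Real.sqrt a * psi d r = Real.sqrt a * (2 * psi d r) := by ring
      _ ≤ _ := by gcongr

end HeatWalk

/-! ### The mean value property for one step of the walk. -/

namespace HeatWalk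

variable {d : ℕ} {T : ℝ} {D : Set (E d)} {f : ℝ → E d → ℝ} {f₀ : E d → ℝ} {u : ℝ → E d → ℝ}

/-- The closed space-time cylinder. -/
abbrev cylinder (T : ℝ) (D : Set (E d)) : Set (ℝ × E d) := Icc 0 T ×ˢ closure D

/-- A function on the closed cylinder, extended by zero. -/
noncomputable def extendZero (T : ℝ) (D : Set (E d)) (u : ℝ → E d → ℝ) : ℝ × E d → ℝ :=
  (cylinder T D).indicator fun p => u p.1 p.2

lemma isClosed_cylinder (T : ℝ) (D : Set (E d)) : IsClosed (cylinder T D) :=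
  isClosed_Icc.prod isClosed_closure

lemma isCompact_cylinder (hD : Bornology.IsBounded D) : IsCompact (cylinder T D) :=
  isCompact_Icc.prod hD.isCompact_closure

lemma extendZero_of_mem {p : ℝ × E d} (hp : p ∈ cylinder T D) : extendZero T D u p = u p.1 p.2 :=
  indicator_of_mem hp _

lemma measurable_indicator_of_continuousOn {X : Type*} [TopologicalSpace X] [MeasurableSpace X]
    [OpensMeasurableSpace X] {g : X → ℝ} {S : Set X} (hS : MeasurableSet S)
    (hg : ContinuousOn g S) : Measurable (S.indicator g) := by
  classical
  rw [← Set.piecewise_eq_indicator]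
  exact hg.measurable_piecewise continuousOn_const hS

lemma IsSolution.measurable_extendZero (hu : IsSolution T D f f₀ u) :
    Measurable (extendZero T D u) :=
  measurable_indicator_of_continuousOn (isClosed_cylinder T D).measurableSet hu.continuousOn_closure

lemma IsSolution.exists_bound (hu : IsSolution T D f f₀ u) (hD : Bornology.IsBounded D) :
    ∃ C, ∀ p, ‖extendZero T D u p‖ ≤ C := by
  obtain ⟨C, hC⟩ := (isCompact_cylinder (T := T) hD).exists_bound_of_continuousOn
    hu.continuousOn_closure
  refine ⟨max C 0, fun p => ?_⟩
  by_cases hp : p ∈ cylinder T D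
  · rw [extendZero_of_mem hp]
    exact (hC p hp).trans (le_max_left _ _)
  · rw [extendZero, indicator_of_notMem hp, norm_zero]
    exact le_max_right _ _

lemma ae_noise_radius_mem (hd : 0 < d) :
    ∀ᵐ z ∂noiseLaw d, radius d z.1.1 z.1.2 ∈ Icc (0 : ℝ) 1 := by
  have := isProbabilityMeasure_sphereUniform hd
  exact (Measure.quasiMeasurePreserving_fst (μ := seedLaw d) (ν := sphereUniform d)).ae
    (ae_radius_mem_Icc hd)

lemma IsSolution.integrable_scaledStep (hd : 0 < d) (hD : Bornology.IsBounded D)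
    (hu : IsSolution T D f f₀ u) (a : ℝ) (p : ℝ × E d) :
    Integrable (fun z => extendZero T D u (scaledStep a p z)) (noiseLaw d) := by
  have := isProbabilityMeasure_sphereUniform hd
  obtain ⟨C, hC⟩ := hu.exists_bound hD
  exact Integrable.of_bound (hu.measurable_extendZero.comp
    (measurable_scaledStep measurable_const measurable_const measurable_id)).aestronglyMeasurable C
    (Eventually.of_forall fun z => hC _)

/-- The mean value property over a heat sphere whose heat ball is compactly contained in the
domain. -/
lemma IsSolution.integral_scaledStep_of_lt (hd : 0 < d) (hDo : IsOpen D)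
    (hDb : Bornology.IsBounded D) (hu : IsSolution T D f f₀ u) {p : ℝ × E d}
    (hp : p ∈ cylinder T D) {a : ℝ} (ha : 0 < a) (haα : a < alpha D p.1 p.2) :
    ∫ z, extendZero T D u (scaledStep a p z) ∂noiseLaw d = u p.1 p.2 := by
  have := isProbabilityMeasure_sphereUniform hd
  have hd' : (0 : ℝ) < d := Nat.cast_pos.2 hd
  have hsa : 0 < Real.sqrt a := Real.sqrt_pos.2 ha
  set δ := Metric.infDist p.2 (frontier D)
  set r₀ := 2 * Real.sqrt (d / (2 * Real.exp 1))
  have hr₀pos : 0 < r₀ := by have := Real.exp_pos 1; positivity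
  -- The strict inequality keeps the heat ball away from ∂D, so that u is C^{1,2} on all the spheres
  -- involved.
  have hlt : Real.sqrt a * r₀ < δ := by
    refine lt_of_lt_of_le ?_ (sqrt_mul_maxRadius_le hd (ha.trans haα).le le_rfl)
    exact mul_lt_mul_of_pos_right (Real.sqrt_lt_sqrt ha.le haα) hr₀pos
  have hδ : 0 < δ := (mul_pos hsa hr₀pos).trans hlt
  have hpD : p.2 ∈ D := by
    by_contra hcon
    have : p.2 ∈ frontier D := ⟨hp.2, by rwa [hDo.interior_eq]⟩
    exact hδ.ne' (Metric.infDist_zero_of_mem this)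
  have hr₀ : ∀ s ∈ Icc (0 : ℝ) 1, ballRadius d s ≤ r₀ := fun s hs =>
    mul_le_mul_of_nonneg_left (psi_le hs) zero_le_two
  have H := hu.isRadialCaloric hd hp.1.2 ha (haα.le.trans (alpha_le _ _))
    (ball_infDist_frontier_subset hpD) hlt
  have mv := H.integral_heatWeight_mul hd hr₀
  have cs := continuousOn_sphere_section (m := fun s r =>
    ∫ v, u (p.1 - a * s) (p.2 + (Real.sqrt a * r) • (v : E d)) ∂surface d) hr₀ H.cont
  set c : ENNReal := ((surface d) univ)⁻¹
  have hc : sphereUniform d = c • surface d := rfl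
  have hmem : ∀ s ∈ Icc (0 : ℝ) 1, ∀ v : Metric.sphere (0 : E d) 1,
      (p.1 - a * s, p.2 + (2 * Real.sqrt a * psi d s) • (v : E d)) ∈ cylinder T D := fun s hs v =>
    prod_mono_left (Icc_subset_Icc_right hp.1.2) (step_mem hd hDo hp.2 ha.le haα.le hs v)
  have hgeq : ∀ s ∈ Icc (0 : ℝ) 1, ∫ v : Metric.sphere (0 : E d) 1,
      extendZero T D u (p.1 - a * s, p.2 + (2 * Real.sqrt a * psi d s) • (v : E d)) ∂sphereUniform d =
      c.toReal * ∫ v, u (p.1 - a * s) (p.2 + (Real.sqrt a * ballRadius d s) • (v : E d))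
        ∂surface d := by
    intro s hs
    rw [hc, integral_smul_measure, smul_eq_mul]
    congr 2
    ext v
    rw [extendZero_of_mem (hmem s hs v), ballRadius]
    simp only
    congr 3; ring
  have hgc : ContinuousOn (fun s => ∫ v : Metric.sphere (0 : E d) 1,
      extendZero T D u (p.1 - a * s, p.2 + (2 * Real.sqrt a * psi d s) • (v : E d))
        ∂sphereUniform d) (Icc 0 1) :=
    (continuousOn_const.mul cs).congr hgeq
  have law := integral_radius_comp_mul hd hgc
  have hW := integral_heatWeight_pos hd
  have hI : ∫ z, extendZero T D u (scaledStep a p z) ∂noiseLaw d = ∫ x, (∫ v, extendZero T D u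
      (p.1 - a * radius d x.1 x.2, p.2 + (2 * Real.sqrt a * psi d (radius d x.1 x.2)) • (v : E d))
        ∂sphereUniform d) ∂seedLaw d :=
    integral_prod _ (hu.integrable_scaledStep hd hDb a p)
  rw [hI]
  -- Multiplying by the total weight turns the expectation over R into an integral against
  -- `heatWeight`, to which the mean value property applies.
  refine mul_right_cancel₀ hW.ne' (law.trans ?_)
  rw [setIntegral_congr_fun (g := fun s => c.toReal * (heatWeight d s *
    ∫ v, u (p.1 - a * s) (p.2 + (Real.sqrt a * ballRadius d s) • (v : E d)) ∂surface d))
    measurableSet_Ioo (fun s hs => by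
      simp only [hgeq s (Ioo_subset_Icc_self hs)]; ring), integral_const_mul]
  rw [intervalIntegral.integral_of_le zero_le_one, intervalIntegral.integral_of_le zero_le_one,
    integral_Ioc_eq_integral_Ioo, integral_Ioc_eq_integral_Ioo] at mv
  rw [mv]
  have hone : c.toReal * (surface d).real univ = 1 := by
    have h1 : (sphereUniform d).real univ = 1 := by simp
    rwa [hc, measureReal_ennreal_smul_apply] at h1
  simp only [mul_zero, sub_zero, zero_smul, add_zero, integral_const, smul_eq_mul]
  calc _ = (c.toReal * (surface d).real univ) * (u p.1 p.2 * ∫ s in Ioo (0 : ℝ) 1, heatWeight d s) := by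
        ring
    _ = _ := by rw [hone, one_mul]

/-- One step of the walk of parameter `α`. -/
theorem IsSolution.integral_scaledStep (hd : 0 < d) (hDo : IsOpen D)
    (hDb : Bornology.IsBounded D) (hu : IsSolution T D f f₀ u) {p : ℝ × E d}
    (hp : p ∈ cylinder T D) :
    ∫ z, extendZero T D u (scaledStep (alpha D p.1 p.2) p z) ∂noiseLaw d = u p.1 p.2 := by
  have := isProbabilityMeasure_sphereUniform hd
  have hα := alpha_nonneg (D := D) hp.1.1 p.2
  rcases hα.eq_or_lt with h0 | hpos
  · rw [← h0]
    simp [scaledStep, extendZero_of_mem hp]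
  obtain ⟨C, hC⟩ := hu.exists_bound hDb
  -- The heat ball of parameter α may touch ∂D or time 0. The parameter is approached from below,
  -- where the identity is known, and continuity of u on the closed cylinder suffices.
  have hlim : Tendsto (fun a => ∫ z, extendZero T D u (scaledStep a p z) ∂noiseLaw d)
      (𝓝[<] (alpha D p.1 p.2))
      (𝓝 (∫ z, extendZero T D u (scaledStep (alpha D p.1 p.2) p z) ∂noiseLaw d)) := by
    refine tendsto_integral_filter_of_dominated_convergence (fun _ => C) ?_ ?_ ?_ ?_
    · exact Eventually.of_forall fun a =>
        (hu.integrable_scaledStep hd hDb a p).aestronglyMeasurable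
    · exact Eventually.of_forall fun a => Eventually.of_forall fun z => hC _
    · exact integrable_const _
    · filter_upwards [ae_noise_radius_mem hd] with z hz
      have hm : ∀ a ∈ Icc 0 (alpha D p.1 p.2), scaledStep a p z ∈ cylinder T D := fun a ha =>
        prod_mono_left (Icc_subset_Icc_right hp.1.2) (step_mem hd hDo hp.2 ha.1 ha.2 hz z.2)
      have hcont : ContinuousOn (fun a => u (scaledStep a p z).1 (scaledStep a p z).2)
          (Icc 0 (alpha D p.1 p.2)) :=
        hu.continuousOn_closure.comp (f := fun a => scaledStep a p z)
          (by unfold scaledStep; fun_prop) hm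
      have hcont' : ContinuousOn (fun a => extendZero T D u (scaledStep a p z))
          (Icc 0 (alpha D p.1 p.2)) := hcont.congr fun a ha => extendZero_of_mem (hm a ha)
      exact (hcont' _ (right_mem_Icc.2 hα)).mono_left
        (nhdsWithin_le_iff.2 (Icc_mem_nhdsLT hpos))
  refine tendsto_nhds_unique hlim (tendsto_const_nhds.congr' ?_)
  filter_upwards [Ioo_mem_nhdsLT hpos] with a ha
  exact (hu.integral_scaledStep_of_lt hd hDo hDb hp ha.1 ha.2).symm

end HeatWalk

/-! ### Independence of the noise and of the past of the walk. -/

namespace HeatWalk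

/-- Rectangles form a generating π-system, and on them the probability splits, first between the two
sequences and then within each. Applied twice, this merges U, G and V into one independent sequence.
-/
lemma iIndepFun_prodMk {ι Ω : Type*} [MeasurableSpace Ω] {P : Measure Ω} {α β : ι → Type*}
    [∀ i, MeasurableSpace (α i)] [∀ i, MeasurableSpace (β i)]
    {X : ∀ i, Ω → α i} {Y : ∀ i, Ω → β i} (mX : ∀ i, Measurable (X i)) (mY : ∀ i, Measurable (Y i))
    (hX : iIndepFun X P) (hY : iIndepFun Y P)
    (hXY : IndepFun (fun ω i => X i ω) (fun ω i => Y i ω) P) :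
    iIndepFun (fun i ω => (X i ω, Y i ω)) P := by
  rw [iIndepFun_iff_iIndep]
  set π : ι → Set (Set Ω) := fun i => preimage (fun ω => (X i ω, Y i ω)) ''
    (image2 (· ×ˢ ·) {s : Set (α i) | MeasurableSet s} {t : Set (β i) | MeasurableSet t})
  refine iIndepSets.iIndep (fun i => ((mX i).prodMk (mY i)).comap_le) π (fun i => ?_) (fun i => ?_) ?_
  · exact isPiSystem_prod.comap _
  · rw [← generateFrom_prod, MeasurableSpace.comap_generateFrom]
  · rw [iIndepSets_iff]
    intro s F hF
    have hF' : ∀ i, ∃ A : Set (α i), ∃ B : Set (β i), i ∈ s →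
        MeasurableSet A ∧ MeasurableSet B ∧ F i = X i ⁻¹' A ∩ Y i ⁻¹' B := by
      intro i
      by_cases hi : i ∈ s
      · obtain ⟨_, ⟨A, hA, B, hB, rfl⟩, h⟩ := hF i hi
        exact ⟨A, B, fun _ => ⟨hA, hB, h.symm⟩⟩
      · exact ⟨∅, ∅, fun h => absurd h hi⟩
    choose A B hAB using hF'
    have hX' := hX.measure_inter_preimage_eq_mul
    have hY' := hY.measure_inter_preimage_eq_mul
    -- Stated for all subsets of s: the set s itself gives the joint probability and singletons give
    -- the factors.
    have key : ∀ S : Finset ι, (∀ i ∈ S, i ∈ s) → P (⋂ i ∈ S, F i) =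
        (∏ i ∈ S, P (X i ⁻¹' A i)) * ∏ i ∈ S, P (Y i ⁻¹' B i) := by
      intro S hS
      have h1 : ⋂ i ∈ S, F i = ((fun ω i => X i ω) ⁻¹' ((S : Set ι).pi A)) ∩
          ((fun ω i => Y i ω) ⁻¹' ((S : Set ι).pi B)) := by
        ext ω
        simp only [mem_iInter, mem_inter_iff, mem_preimage, Set.mem_pi, Finset.mem_coe,
          ← forall_and]
        refine forall_congr' fun i => ?_
        refine imp_congr_right fun hi => ?_
        rw [(hAB i (hS i hi)).2.2]; rfl
      rw [h1, hXY.measure_inter_preimage_eq_mul _ _ (MeasurableSet.pi S.countable_toSet fun i hi => (hAB i (hS i hi)).1)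
        (MeasurableSet.pi S.countable_toSet fun i hi => (hAB i (hS i hi)).2.1),
        ← hX' S fun i hi => (hAB i (hS i hi)).1, ← hY' S fun i hi => (hAB i (hS i hi)).2.1]
      congr 2 <;> · ext ω; simp [Set.mem_pi]
    rw [key s fun i hi => hi, ← Finset.prod_mul_distrib]
    refine Finset.prod_congr rfl fun i hi => ?_
    have := key {i} (by simpa using hi)
    simpa using this.symm

variable {d : ℕ} {Ω : Type*} [MeasurableSpace Ω] {P : Measure Ω}
  {U : ℕ → Ω → (Fin (d / 2 + 1) → ℝ)} {G : ℕ → Ω → ℝ} {V : ℕ → Ω → Metric.sphere (0 : E d) 1}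

/-- The driving noise, as a single sequence. -/
def noise (U : ℕ → Ω → (Fin (d / 2 + 1) → ℝ)) (G : ℕ → Ω → ℝ)
    (V : ℕ → Ω → Metric.sphere (0 : E d) 1) (n : ℕ) (ω : Ω) :
    ((Fin (d / 2 + 1) → ℝ) × ℝ) × Metric.sphere (0 : E d) 1 :=
  ((U n ω, G n ω), V n ω)

lemma IsNoise.measurable_noise (h : IsNoise P U G V) (n : ℕ) : Measurable (noise U G V n) :=
  ((h.measurable_U n).prodMk (h.measurable_G n)).prodMk (h.measurable_V n)

lemma IsNoise.iIndepFun_noise (h : IsNoise P U G V) : iIndepFun (noise U G V) P := by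
  have h1 := iIndepFun_prodMk h.measurable_G h.measurable_V h.indep_G h.indep_V h.indep_G_V
  have h2 : IndepFun (fun ω n => U n ω) (fun ω n => (G n ω, V n ω)) P :=
    h.indep_U_GV.comp (ψ := fun (p : (ℕ → ℝ) × (ℕ → Metric.sphere (0 : E d) 1)) n => (p.1 n, p.2 n))
      measurable_id (measurable_pi_lambda _ fun n => by fun_prop)
  have h3 := iIndepFun_prodMk h.measurable_U (fun n => (h.measurable_G n).prodMk (h.measurable_V n))
    h.indep_U h1 h2
  exact h3.comp (fun _ p => ((p.1, p.2.1), p.2.2)) fun _ => by fun_prop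

lemma IsNoise.map_noise [IsProbabilityMeasure P] (h : IsNoise P U G V) (n : ℕ) : P.map (noise U G V n) = noiseLaw d := by
  have h1 : IndepFun (G n) (V n) P :=
    h.indep_G_V.comp (φ := fun g : ℕ → ℝ => g n)
      (ψ := fun v : ℕ → Metric.sphere (0 : E d) 1 => v n) (by fun_prop) (by fun_prop)
  have h2 : IndepFun (U n) (fun ω => (G n ω, V n ω)) P :=
    h.indep_U_GV.comp (φ := fun u : ℕ → (Fin (d / 2 + 1) → ℝ) => u n)
      (ψ := fun (p : (ℕ → ℝ) × (ℕ → Metric.sphere (0 : E d) 1)) => (p.1 n, p.2 n))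
      (by fun_prop) (by fun_prop)
  have mGV := (h.measurable_G n).prodMk (h.measurable_V n)
  have e1 := h1.map_prod_eq_prod_map_map (h.measurable_G n).aemeasurable
    (h.measurable_V n).aemeasurable
  have e2 := h2.map_prod_eq_prod_map_map (h.measurable_U n).aemeasurable mGV.aemeasurable
  rw [e1, h.law_U, h.law_G, h.law_V] at e2
  have : IsProbabilityMeasure (sphereUniform d) := by
    rw [← h.law_V n]; exact Measure.isProbabilityMeasure_map (h.measurable_V n).aemeasurable
  have e3 := (measurePreserving_prodAssoc ((volume : Measure (Fin (d / 2 + 1) → ℝ)).restrict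
    (Icc 0 1)) (gaussianReal 0 1) (sphereUniform d)).symm.map_eq
  rw [← e2, Measure.map_map (MeasurableEquiv.measurable _) ((h.measurable_U n).prodMk mGV)] at e3
  exact e3

/-- The information available after `n` steps. -/
def noiseFiltration (hm : ∀ n, Measurable (noise U G V n)) : Filtration ℕ ‹MeasurableSpace Ω› where
  seq n := ⨆ k ∈ Iio n, MeasurableSpace.comap (noise U G V k) inferInstance
  mono' _ _ hmn := biSup_mono fun _ hk => lt_of_lt_of_le hk hmn
  le' _ := iSup₂_le fun k _ => (hm k).comap_le

/-- The σ-algebra of index n is generated by the noises of index below n, exactly those that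
determine the walk up to step n. -/
lemma IsNoise.indep_noiseFiltration (h : IsNoise P U G V) (n : ℕ) :
    Indep (MeasurableSpace.comap (noise U G V n) inferInstance)
      (noiseFiltration h.measurable_noise n) P := by
  have := indep_iSup_of_disjoint (fun i => (h.measurable_noise i).comap_le) h.iIndepFun_noise.iIndep
    (S := {n}) (T := Iio n) (by simp)
  simpa [noiseFiltration] using this

lemma walk_succ {Ω : Type*} {U : ℕ → Ω → (Fin (d / 2 + 1) → ℝ)} {G : ℕ → Ω → ℝ}
    {V : ℕ → Ω → Metric.sphere (0 : E d) 1} (D : Set (E d)) (t : ℝ) (x : E d) (n : ℕ) (ω : Ω) :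
    walk D U G V t x (n + 1) ω = scaledStep
      (alpha D (walk D U G V t x n ω).1 (walk D U G V t x n ω).2) (walk D U G V t x n ω)
      (noise U G V n ω) := rfl

lemma measurable_walk_filtration (hm : ∀ n, Measurable (noise U G V n)) (D : Set (E d)) (t : ℝ)
    (x : E d) (n : ℕ) : Measurable[noiseFiltration hm n] (walk D U G V t x n) := by
  induction n with
  | zero => exact @measurable_const _ _ _ (noiseFiltration hm 0) _
  | succ n ih =>
    have h1 : Measurable[noiseFiltration hm (n + 1)] (walk D U G V t x n) :=
      ih.mono ((noiseFiltration hm).mono n.le_succ) le_rfl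
    have h2 : Measurable[noiseFiltration hm (n + 1)] (noise U G V n) := by
      rw [measurable_iff_comap_le]
      exact le_iSup₂_of_le (f := fun k (_ : k ∈ Iio (n + 1)) =>
        MeasurableSpace.comap (noise U G V k) inferInstance) n (Nat.lt_succ_self n) le_rfl
    have h0 : Measurable fun p : ℝ × E d => alpha D p.1 p.2 := continuous_alpha.measurable
    have h3 := @measurable_scaledStep d Ω (noiseFiltration hm (n + 1))
      (fun ω => alpha D (walk D U G V t x n ω).1 (walk D U G V t x n ω).2) (walk D U G V t x n)
      (noise U G V n) (h0.comp h1) h1 h2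
    simpa only [← walk_succ] using h3

lemma measurable_walk (hm : ∀ n, Measurable (noise U G V n)) (D : Set (E d)) (t : ℝ)
    (x : E d) (n : ℕ) : Measurable (walk D U G V t x n) :=
  (measurable_walk_filtration hm D t x n).mono ((noiseFiltration hm).le n) le_rfl

/-- The position after `n` steps and the next noise have the product law. -/
lemma IsNoise.map_walk_noise [IsProbabilityMeasure P] (h : IsNoise P U G V) (D : Set (E d)) (t : ℝ) (x : E d) (n : ℕ) :
    P.map (fun ω => (walk D U G V t x n ω, noise U G V n ω)) =
      (P.map (walk D U G V t x n)).prod (noiseLaw d) := by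
  have hw := measurable_walk h.measurable_noise D t x n
  have hind : IndepFun (walk D U G V t x n) (noise U G V n) P := by
    rw [IndepFun_iff_Indep]
    exact indep_of_indep_of_le_left (h.indep_noiseFiltration n).symm
      (measurable_walk_filtration h.measurable_noise D t x n).comap_le
  rw [← h.map_noise n]
  exact hind.map_prod_eq_prod_map_map hw.aemeasurable (h.measurable_noise n).aemeasurable

end HeatWalk

/-! ### Conservation of expectation and almost sure convergence of the walk. -/

namespace HeatWalk

variable {d : ℕ} {T : ℝ} {D : Set (E d)} {f : ℝ → E d → ℝ} {f₀ : E d → ℝ} {u : ℝ → E d → ℝ}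

/-- A linear form is harmonic, and its flux through the unit sphere is its own integral over the
sphere. It makes the spatial steps centred. -/
lemma integral_sphere_clm_eq_zero (hd : 0 < d) (L : E d →L[ℝ] ℝ) :
    ∫ v : Metric.sphere (0 : E d) 1, L (v : E d) ∂sphereUniform d = 0 := by
  have hw : ContDiffOn ℝ 2 L (Metric.ball (0 : E d) 2) := L.contDiff.contDiffOn
  have h := sphere_flux_eq hd hw (r := 1) ⟨by norm_num, by norm_num⟩
  have hlap : ∀ τ ∈ uIcc (0 : ℝ) 1, τ ^ (d - 1) *
      ∫ v, Laplacian.laplacian (L : E d → ℝ) ((0 : E d) + τ • (v : E d)) ∂surface d = 0 := by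
    intro τ hτ
    rw [uIcc_of_le zero_le_one] at hτ
    rw [integral_eq_zero_of_ae, mul_zero]
    refine Eventually.of_forall fun v => ?_
    simp only [Pi.zero_apply]
    rw [laplacian_eq_sum_fderiv_fderiv hw
      (add_smul_mem_ball v ⟨by linarith [hτ.1], by linarith [hτ.2]⟩)]
    simp
  rw [intervalIntegral.integral_congr (g := fun _ => (0 : ℝ)) hlap] at h
  simp only [one_pow, one_mul, ContinuousLinearMap.fderiv, intervalIntegral.integral_zero] at h
  rw [sphereUniform, integral_smul_measure, h, smul_zero]

section walk

variable {Ω : Type*} [MeasurableSpace Ω] {P : Measure Ω} [IsProbabilityMeasure P]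
  {U : ℕ → Ω → (Fin (d / 2 + 1) → ℝ)} {G : ℕ → Ω → ℝ} {V : ℕ → Ω → Metric.sphere (0 : E d) 1}

lemma IsNoise.ae_radius_mem (hd : 0 < d) (h : IsNoise P U G V) :
    ∀ᵐ ω ∂P, ∀ n, radius d (U n ω) (G n ω) ∈ Icc (0 : ℝ) 1 := by
  rw [ae_all_iff]
  intro n
  have := ae_noise_radius_mem hd
  rw [← h.map_noise n] at this
  exact ae_of_ae_map (h.measurable_noise n).aemeasurable this

lemma IsNoise.ae_radius_pos (hd : 0 < d) (h : IsNoise P U G V) (n : ℕ) :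
    ∀ᵐ ω ∂P, 0 < radius d (U n ω) (G n ω) := by
  have := isProbabilityMeasure_sphereUniform hd
  have : ∀ᵐ z ∂noiseLaw d, 0 < radius d z.1.1 z.1.2 :=
    (Measure.quasiMeasurePreserving_fst (μ := seedLaw d) (ν := sphereUniform d)).ae
    (HeatWalk.ae_radius_pos (d := d))
  rw [← h.map_noise n] at this
  exact ae_of_ae_map (h.measurable_noise n).aemeasurable this

lemma IsNoise.ae_walk_mem (hd : 0 < d) (hD : IsOpen D) (h : IsNoise P U G V) {t : ℝ} (ht : 0 ≤ t)
    {x : E d} (hx : x ∈ closure D) :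
    ∀ᵐ ω ∂P, (∀ n, walk D U G V t x n ω ∈ Icc 0 t ×ˢ closure D) ∧
      Antitone fun n => (walk D U G V t x n ω).1 := by
  filter_upwards [h.ae_radius_mem hd] with ω hω
  have hmem : ∀ n, walk D U G V t x n ω ∈ Icc 0 t ×ˢ closure D := by
    intro n
    induction n with
    | zero => exact ⟨⟨ht, le_rfl⟩, hx⟩
    | succ n ih =>
      exact prod_mono_left (Icc_subset_Icc_right ih.1.2)
        (step_mem hd hD ih.2 (alpha_nonneg ih.1.1 _) le_rfl (hω n) (V n ω))
  refine ⟨hmem, antitone_nat_of_succ_le fun n => ?_⟩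
  exact (step_mem hd hD (hmem n).2 (alpha_nonneg (hmem n).1.1 _) le_rfl (hω n) (V n ω)).1.2

/-- Markov property in integrated form: the current position may be frozen while averaging over the
next noise. -/
lemma IsNoise.integral_walk_noise (h : IsNoise P U G V) (t : ℝ) (x : E d) (n : ℕ)
    {g : (ℝ × E d) × (((Fin (d / 2 + 1) → ℝ) × ℝ) × Metric.sphere (0 : E d) 1) → ℝ}
    (hg : Integrable g ((P.map (walk D U G V t x n)).prod (noiseLaw d))) :
    ∫ ω, g (walk D U G V t x n ω, noise U G V n ω) ∂P =
      ∫ ω, ∫ z, g (walk D U G V t x n ω, z) ∂noiseLaw d ∂P := by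
  have : IsProbabilityMeasure (noiseLaw d) := by
    rw [← h.map_noise n]; exact Measure.isProbabilityMeasure_map (h.measurable_noise n).aemeasurable
  have hw := measurable_walk h.measurable_noise D t x n
  have h1 := h.map_walk_noise D t x n
  rw [← integral_map (φ := fun ω => (walk D U G V t x n ω, noise U G V n ω))
    (hw.prodMk (h.measurable_noise n)).aemeasurable (by rw [h1]; exact hg.aestronglyMeasurable), h1,
    integral_prod _ hg, integral_map hw.aemeasurable]
  exact hg.aestronglyMeasurable.integral_prod_right'

/-- Along the walk, the expectation of a solution is constant. -/
lemma IsSolution.integral_walk (hd : 0 < d) (hDo : IsOpen D) (hDb : Bornology.IsBounded D)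
    (hu : IsSolution T D f f₀ u) (h : IsNoise P U G V) {t : ℝ} (ht : t ∈ Icc 0 T)
    {x : E d} (hx : x ∈ closure D) (n : ℕ) :
    ∫ ω, extendZero T D u (walk D U G V t x n ω) ∂P = u t x := by
  induction n with
  | zero => simp [walk, extendZero_of_mem (show (t, x) ∈ cylinder T D from ⟨ht, hx⟩)]
  | succ n ih =>
    have : IsProbabilityMeasure (noiseLaw d) := by
      rw [← h.map_noise n]
      exact Measure.isProbabilityMeasure_map (h.measurable_noise n).aemeasurable
    have hw := measurable_walk h.measurable_noise D t x n
    have : IsProbabilityMeasure (P.map (walk D U G V t x n)) :=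
      Measure.isProbabilityMeasure_map hw.aemeasurable
    obtain ⟨C, hC⟩ := hu.exists_bound hDb
    have hα : Measurable fun p : ℝ × E d => alpha D p.1 p.2 := continuous_alpha.measurable
    have hg : Integrable (fun q : (ℝ × E d) ×
        (((Fin (d / 2 + 1) → ℝ) × ℝ) × Metric.sphere (0 : E d) 1) =>
        extendZero T D u (scaledStep (alpha D q.1.1 q.1.2) q.1 q.2))
        ((P.map (walk D U G V t x n)).prod (noiseLaw d)) :=
      Integrable.of_bound (hu.measurable_extendZero.comp
        (measurable_scaledStep (hα.comp measurable_fst) measurable_fst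
          measurable_snd)).aestronglyMeasurable C (Eventually.of_forall fun _ => hC _)
    have key := h.integral_walk_noise (D := D) t x n hg
    simp only [← walk_succ] at key
    rw [key, ← ih]
    refine integral_congr_ae ?_
    filter_upwards [h.ae_walk_mem hd hDo ht.1 hx] with ω hω
    have hm : walk D U G V t x n ω ∈ cylinder T D :=
      prod_mono_left (Icc_subset_Icc_right ht.2) (hω.1 n)
    rw [hu.integral_scaledStep hd hDo hDb hm, extendZero_of_mem hm]

lemma integral_radius_pos (hd : 0 < d) : 0 < ∫ z, radius d z.1.1 z.1.2 ∂noiseLaw d := by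
  have := isProbabilityMeasure_sphereUniform hd
  have h1 : ∫ z, radius d z.1.1 z.1.2 ∂noiseLaw d = ∫ x, radius d x.1 x.2 ∂seedLaw d := by
    have := integral_fun_fst (μ := seedLaw d) (ν := sphereUniform d) fun x => radius d x.1 x.2
    simpa using this
  have h2 := integral_radius_pow hd 1
  simp only [pow_one] at h2
  rw [h1, h2]
  have hd' : (0 : ℝ) < d := Nat.cast_pos.2 hd
  positivity

/-- The expected size of the steps tends to zero. -/
lemma IsNoise.tendsto_integral_alpha (hd : 0 < d) (hD : IsOpen D) (h : IsNoise P U G V) {t : ℝ}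
    (ht : 0 ≤ t) {x : E d} (hx : x ∈ closure D) :
    Tendsto (fun n => ∫ ω, alpha D (walk D U G V t x n ω).1 (walk D U G V t x n ω).2 ∂P) atTop
      (𝓝 0) := by
  have hw := measurable_walk h.measurable_noise D t x
  have hα : Measurable fun p : ℝ × E d => alpha D p.1 p.2 := continuous_alpha.measurable
  have hmem := h.ae_walk_mem hd hD ht hx
  -- Times decrease to a limit and stay in [0,t], so their increments tend to 0 boundedly.
  have hdiff : Tendsto (fun n => ∫ ω, ((walk D U G V t x n ω).1 - (walk D U G V t x (n + 1) ω).1) ∂P)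
      atTop (𝓝 (∫ _, (0 : ℝ) ∂P)) := by
    refine tendsto_integral_of_dominated_convergence (fun _ => t)
      (fun n => ((hw n).fst.sub (hw (n + 1)).fst).aestronglyMeasurable) (integrable_const _)
      (fun n => ?_) ?_
    · filter_upwards [hmem] with ω hω
      have h1 := (hω.1 n).1
      have h2 := (hω.1 (n + 1)).1
      have h3 := hω.2 n.le_succ
      simp only at h3
      rw [Real.norm_eq_abs, abs_le]
      exact ⟨by linarith [h1.1], by linarith [h1.2, h2.1]⟩
    · filter_upwards [hmem] with ω hω
      have hc := tendsto_atTop_ciInf hω.2 ⟨0, by rintro _ ⟨n, rfl⟩; exact (hω.1 n).1.1⟩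
      simpa using hc.sub (hc.comp (tendsto_add_atTop_nat 1))
  have hr := integral_radius_pos hd
  have heq : ∀ n, ∫ ω, ((walk D U G V t x n ω).1 - (walk D U G V t x (n + 1) ω).1) ∂P =
      (∫ ω, alpha D (walk D U G V t x n ω).1 (walk D U G V t x n ω).2 ∂P) *
        ∫ z, radius d z.1.1 z.1.2 ∂noiseLaw d := by
    intro n
    have : IsProbabilityMeasure (noiseLaw d) := by
      rw [← h.map_noise n]
      exact Measure.isProbabilityMeasure_map (h.measurable_noise n).aemeasurable
    have hi1 : Integrable (fun p : ℝ × E d => alpha D p.1 p.2) (P.map (walk D U G V t x n)) := by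
      rw [integrable_map_measure hα.aestronglyMeasurable (hw n).aemeasurable]
      refine Integrable.of_bound (hα.comp (hw n)).aestronglyMeasurable t ?_
      filter_upwards [hmem] with ω hω
      have h1 := (hω.1 n).1
      simp only [Function.comp]
      rw [Real.norm_of_nonneg (alpha_nonneg h1.1 _)]
      exact (alpha_le _ _).trans h1.2
    -- Otherwise the integral would be 0 by convention, against its positivity.
    have hi2 : Integrable (fun z => radius d z.1.1 z.1.2) (noiseLaw d) := by
      by_contra hcon
      rw [integral_undef hcon] at hr
      exact lt_irrefl _ hr
    have key := h.integral_walk_noise (D := D) t x n (hi1.mul_prod hi2)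
    simp only [integral_const_mul, integral_mul_const] at key
    rw [← key]
    congr 1
    ext ω
    simp [walk_succ, scaledStep]
  simp only [heq, integral_zero] at hdiff
  have := hdiff.div_const (∫ z, radius d z.1.1 z.1.2 ∂noiseLaw d)
  simpa [mul_div_assoc, div_self hr.ne'] using this

/-- The coordinates of the walk are bounded martingales. -/
lemma IsNoise.martingale_walk (hd : 0 < d) (hDo : IsOpen D) (hDb : Bornology.IsBounded D)
    (h : IsNoise P U G V) {t : ℝ} (ht : 0 ≤ t) {x : E d} (hx : x ∈ closure D) (i : Fin d) :
    Martingale (fun n ω => (walk D U G V t x n ω).2 i) (noiseFiltration h.measurable_noise) P ∧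
      ∃ C : NNReal, ∀ n, eLpNorm (fun ω => (walk D U G V t x n ω).2 i) 1 P ≤ C := by
  have := isProbabilityMeasure_sphereUniform hd
  set ℱ := noiseFiltration h.measurable_noise
  have hw := measurable_walk h.measurable_noise D t x
  have hwF := measurable_walk_filtration h.measurable_noise D t x
  have hmem := h.ae_walk_mem hd hDo ht hx
  have hcoord : Measurable fun p : ℝ × E d => p.2 i := by fun_prop
  have hα : Measurable fun p : ℝ × E d => 2 * Real.sqrt (alpha D p.1 p.2) :=
    (continuous_alpha.measurable.sqrt).const_mul 2
  obtain ⟨C, hC⟩ := hDb.closure.exists_norm_le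
  have hbound : ∀ n, ∀ᵐ ω ∂P, ‖(walk D U G V t x n ω).2 i‖ ≤ C := fun n => by
    filter_upwards [hmem] with ω hω
    exact (PiLp.norm_apply_le _ i).trans (hC _ (hω.1 n).2)
  have hint : ∀ n, Integrable (fun ω => (walk D U G V t x n ω).2 i) P := fun n =>
    Integrable.of_bound (hcoord.comp (hw n)).aestronglyMeasurable C (hbound n)
  refine ⟨martingale_of_condExp_sub_eq_zero_nat
    (fun n => (hcoord.comp (hwF n)).stronglyMeasurable) hint fun n => ?_, C.toNNReal, fun n => ?_⟩
  -- The increment is the past-measurable factor 2√α times B of the fresh noise, and B has mean zero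
  -- because the direction is centred and independent of the radius.
  · set B : ((Fin (d / 2 + 1) → ℝ) × ℝ) × Metric.sphere (0 : E d) 1 → ℝ :=
      fun z => psi d (radius d z.1.1 z.1.2) * (z.2 : E d) i
    have hBm : Measurable B := by
      refine Measurable.mul ((measurable_psi d).comp ((measurable_radius d).comp measurable_fst)) ?_
      have : Measurable fun v : E d => v i := by fun_prop
      exact this.comp (measurable_subtype_coe.comp measurable_snd)
    have hB0 : ∫ z, B z ∂noiseLaw d = 0 := by
      have h1 := integral_prod_mul (μ := seedLaw d) (ν := sphereUniform d)
        (fun x => psi d (radius d x.1 x.2)) (fun v : Metric.sphere (0 : E d) 1 => (v : E d) i)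
      have h2 := integral_sphere_clm_eq_zero hd (EuclideanSpace.proj i : E d →L[ℝ] ℝ)
      simp only [PiLp.proj_apply] at h2
      rw [h2, mul_zero] at h1
      exact h1
    have hBn : Measurable[MeasurableSpace.comap (noise U G V n) inferInstance]
        (fun ω => B (noise U G V n ω)) := hBm.comp (comap_measurable _)
    have hBi : Integrable (fun ω => B (noise U G V n ω)) P := by
      refine Integrable.of_bound (hBm.comp (h.measurable_noise n)).aestronglyMeasurable
        (Real.sqrt (d / (2 * Real.exp 1))) ?_
      filter_upwards [h.ae_radius_mem hd] with ω hω
      simp only [B, noise]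
      rw [norm_mul, Real.norm_of_nonneg (psi_nonneg _ _)]
      have h1 : ‖(V n ω : E d) i‖ ≤ 1 := (PiLp.norm_apply_le _ i).trans (norm_eq_of_mem_sphere _).le
      calc _ ≤ Real.sqrt (d / (2 * Real.exp 1)) * 1 :=
            mul_le_mul (psi_le (hω n)) h1 (norm_nonneg _) (Real.sqrt_nonneg _)
        _ = _ := mul_one _
    have hBc : P[fun ω => B (noise U G V n ω) | ℱ n] =ᵐ[P] 0 := by
      have := condExp_indep_eq (h.measurable_noise n).comap_le (ℱ.le n) hBn.stronglyMeasurable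
        (h.indep_noiseFiltration n)
      rw [← integral_map (φ := noise U G V n) (h.measurable_noise n).aemeasurable
        hBm.aestronglyMeasurable, h.map_noise n, hB0] at this
      exact this
    have hAn : StronglyMeasurable[ℱ n]
        fun ω => 2 * Real.sqrt (alpha D (walk D U G V t x n ω).1 (walk D U G V t x n ω).2) :=
      (hα.comp (hwF n)).stronglyMeasurable
    have hstep : (fun ω => (walk D U G V t x (n + 1) ω).2 i) - (fun ω => (walk D U G V t x n ω).2 i) =
        (fun ω => 2 * Real.sqrt (alpha D (walk D U G V t x n ω).1 (walk D U G V t x n ω).2)) *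
          fun ω => B (noise U G V n ω) := by
      ext ω
      simp [walk_succ, scaledStep, B, mul_assoc]
    have hprod := condExp_mul_of_stronglyMeasurable_left hAn
      (by rw [← hstep]; exact (hint (n + 1)).sub (hint n)) hBi
    rw [← hstep] at hprod
    refine hprod.trans ?_
    filter_upwards [hBc] with ω hω
    simp [hω]
  · have := eLpNorm_le_of_ae_bound (p := 1) (hbound n)
    simpa [ENNReal.ofReal] using this

/-- Time converges by monotonicity, each coordinate by the convergence theorem for L¹-bounded
martingales. -/
lemma IsNoise.ae_tendsto_walk (hd : 0 < d) (hDo : IsOpen D) (hDb : Bornology.IsBounded D)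
    (h : IsNoise P U G V) {t : ℝ} (ht : 0 ≤ t) {x : E d} (hx : x ∈ closure D) :
    ∀ᵐ ω ∂P, Tendsto (fun n => walk D U G V t x n ω) atTop (𝓝 (walkLimit D U G V t x ω)) := by
  have h1 : ∀ᵐ ω ∂P, ∀ i, ∃ c, Tendsto (fun n => (walk D U G V t x n ω).2 i) atTop (𝓝 c) := by
    rw [ae_all_iff]
    intro i
    obtain ⟨hm, C, hC⟩ := h.martingale_walk hd hDo hDb ht hx i
    exact hm.submartingale.exists_ae_tendsto_of_bdd hC
  filter_upwards [h1, h.ae_walk_mem hd hDo ht hx] with ω hω hmem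
  choose c hc using hω
  refine tendsto_nhds_limUnder ⟨(⨅ n, (walk D U G V t x n ω).1, WithLp.toLp 2 c), ?_⟩
  refine Tendsto.prodMk_nhds
    (tendsto_atTop_ciInf hmem.2 ⟨0, by rintro _ ⟨n, rfl⟩; exact (hmem.1 n).1.1⟩) ?_
  exact ((PiLp.continuous_toLp 2 _).tendsto c).comp (tendsto_pi_nhds.2 hc)

end walk

end HeatWalk

/-! ### The limit point and the stochastic representation. -/

namespace HeatWalk

variable {d : ℕ} {T : ℝ} {D : Set (E d)} {f : ℝ → E d → ℝ} {f₀ : E d → ℝ} {u : ℝ → E d → ℝ}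

lemma nonempty_frontier_of_isBounded (hd : 0 < d) (hne : D.Nonempty) (hDb : Bornology.IsBounded D) :
    (frontier D).Nonempty := by
  have : Nonempty (Fin d) := ⟨⟨0, hd⟩⟩
  refine nonempty_frontier_iff.2 ⟨hne, ?_⟩
  rintro rfl
  exact NormedSpace.unbounded_univ ℝ (E d) hDb

/-- A nonempty frontier is required, since `Metric.infDist` to the empty set is 0 by convention. -/
lemma alpha_eq_zero (hd : 0 < d) (hfr : (frontier D).Nonempty) {s : ℝ} {y : E d}
    (h : alpha D s y = 0) : s = 0 ∨ y ∈ frontier D := by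
  have hd' : (0 : ℝ) < d := Nat.cast_pos.2 hd
  rcases min_choice s (Real.exp 1 / (2 * d) * Metric.infDist y (frontier D) ^ 2) with h1 | h1
  · exact Or.inl (h1.symm.trans h)
  · right
    have h2 : Real.exp 1 / (2 * d) * Metric.infDist y (frontier D) ^ 2 = 0 := h1.symm.trans h
    rw [mul_eq_zero, or_iff_right (by have := Real.exp_pos 1; positivity), sq_eq_zero_iff] at h2
    exact (isClosed_frontier.mem_iff_infDist_zero hfr).2 h2

section walk

variable {Ω : Type*} [MeasurableSpace Ω] {P : Measure Ω} [IsProbabilityMeasure P]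
  {U : ℕ → Ω → (Fin (d / 2 + 1) → ℝ)} {G : ℕ → Ω → ℝ} {V : ℕ → Ω → Metric.sphere (0 : E d) 1}

lemma IsNoise.aemeasurable_walkLimit (hd : 0 < d) (hDo : IsOpen D) (hDb : Bornology.IsBounded D)
    (h : IsNoise P U G V) {t : ℝ} (ht : 0 ≤ t) {x : E d} (hx : x ∈ closure D) :
    AEMeasurable (walkLimit D U G V t x) P :=
  aemeasurable_of_tendsto_metrizable_ae atTop
    (fun n => (measurable_walk h.measurable_noise D t x n).aemeasurable)
    (h.ae_tendsto_walk hd hDo hDb ht hx)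

lemma IsNoise.ae_walkLimit_mem (hd : 0 < d) (hDo : IsOpen D) (hDb : Bornology.IsBounded D)
    (h : IsNoise P U G V) {t : ℝ} (ht : 0 ≤ t) {x : E d} (hx : x ∈ closure D) :
    ∀ᵐ ω ∂P, walkLimit D U G V t x ω ∈ Icc 0 t ×ˢ closure D ∧
      ∀ n, (walkLimit D U G V t x ω).1 ≤ (walk D U G V t x n ω).1 := by
  filter_upwards [h.ae_tendsto_walk hd hDo hDb ht hx, h.ae_walk_mem hd hDo ht hx] with ω h1 h2
  exact ⟨(isClosed_Icc.prod isClosed_closure).mem_of_tendsto h1 (Eventually.of_forall h2.1),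
    fun n => h2.2.le_of_tendsto (h1.fst_nhds) n⟩

/-- By continuity of α and dominated convergence, the expectation of this nonnegative quantity is
the limit of the expected step sizes, which is 0. -/
lemma IsNoise.ae_alpha_walkLimit (hd : 0 < d) (hDo : IsOpen D) (hDb : Bornology.IsBounded D)
    (h : IsNoise P U G V) {t : ℝ} (ht : 0 ≤ t) {x : E d} (hx : x ∈ closure D) :
    ∀ᵐ ω ∂P, alpha D (walkLimit D U G V t x ω).1 (walkLimit D U G V t x ω).2 = 0 := by
  have hα : Continuous fun p : ℝ × E d => alpha D p.1 p.2 := continuous_alpha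
  have hw := measurable_walk h.measurable_noise D t x
  have hb : ∀ p ∈ Icc 0 t ×ˢ closure D, 0 ≤ alpha D p.1 p.2 ∧ ‖alpha D p.1 p.2‖ ≤ t :=
    fun p hp => by
      have h0 := alpha_nonneg (D := D) hp.1.1 p.2
      exact ⟨h0, by rw [Real.norm_of_nonneg h0]; exact (alpha_le _ _).trans hp.1.2⟩
  have hlim : Tendsto (fun n => ∫ ω, alpha D (walk D U G V t x n ω).1 (walk D U G V t x n ω).2 ∂P)
      atTop (𝓝 (∫ ω, alpha D (walkLimit D U G V t x ω).1 (walkLimit D U G V t x ω).2 ∂P)) := by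
    refine tendsto_integral_of_dominated_convergence (fun _ => t)
      (fun n => (hα.measurable.comp (hw n)).aestronglyMeasurable) (integrable_const _)
      (fun n => ?_) ?_
    · filter_upwards [h.ae_walk_mem hd hDo ht hx] with ω hω using (hb _ (hω.1 n)).2
    · filter_upwards [h.ae_tendsto_walk hd hDo hDb ht hx] with ω hω
      exact (hα.tendsto _).comp hω
  have h0 := tendsto_nhds_unique hlim (h.tendsto_integral_alpha hd hDo ht hx)
  have hmem := h.ae_walkLimit_mem hd hDo hDb ht hx
  have hint : Integrable (fun ω => alpha D (walkLimit D U G V t x ω).1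
      (walkLimit D U G V t x ω).2) P := by
    refine Integrable.of_bound
      (hα.measurable.comp_aemeasurable (h.aemeasurable_walkLimit hd hDo hDb ht hx)).aestronglyMeasurable
      t ?_
    filter_upwards [hmem] with ω hω using (hb _ hω.1).2
  exact (integral_eq_zero_iff_of_nonneg_ae
    (by filter_upwards [hmem] with ω hω using (hb _ hω.1).1) hint).1 h0

/-- The walk stops at time zero or on the lateral boundary. -/
lemma IsNoise.ae_walkLimit_mem_boundary (hd : 0 < d) (hDo : IsOpen D) (hne : D.Nonempty)
    (hDb : Bornology.IsBounded D) (h : IsNoise P U G V) {t : ℝ} (ht : 0 ≤ t) {x : E d}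
    (hx : x ∈ closure D) :
    ∀ᵐ ω ∂P, walkLimit D U G V t x ω ∈ ({0} : Set ℝ) ×ˢ closure D ∪ Ioc 0 t ×ˢ frontier D := by
  have hfr := nonempty_frontier_of_isBounded hd hne hDb
  filter_upwards [h.ae_walkLimit_mem hd hDo hDb ht hx, h.ae_alpha_walkLimit hd hDo hDb ht hx]
    with ω h1 h2
  rcases h1.1.1.1.eq_or_lt with h3 | h3
  · exact Or.inl ⟨h3.symm, h1.1.2⟩
  · exact Or.inr ⟨⟨h3, h1.1.1.2⟩, (alpha_eq_zero hd hfr h2).resolve_left h3.ne'⟩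

/-- If the limit time is positive then t > 0, so α(t,x) > 0 for interior x; the first step then
strictly lowers the time and later steps never raise it. -/
lemma IsNoise.ae_walkLimit_lt (hd : 0 < d) (hDo : IsOpen D) (hne : D.Nonempty)
    (hDb : Bornology.IsBounded D) (h : IsNoise P U G V) {t : ℝ} (ht : 0 ≤ t) {x : E d}
    (hx : x ∈ D) :
    ∀ᵐ ω ∂P, walkLimit D U G V t x ω ∈ ({0} : Set ℝ) ×ˢ closure D ∪ Ioo 0 t ×ˢ frontier D := by
  have hfr := nonempty_frontier_of_isBounded hd hne hDb
  filter_upwards [h.ae_walkLimit_mem_boundary hd hDo hne hDb ht (subset_closure hx),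
    h.ae_walkLimit_mem hd hDo hDb ht (subset_closure hx), h.ae_radius_pos hd 0] with ω h1 h2 h3
  refine h1.imp id fun h4 => ⟨⟨h4.1.1, ?_⟩, h4.2⟩
  have htpos : 0 < t := h4.1.1.trans_le h4.1.2
  have hα : 0 < alpha D t x := by
    refine (alpha_nonneg ht x).lt_of_ne fun h0 => ?_
    rcases alpha_eq_zero hd hfr h0.symm with h5 | h5
    · exact htpos.ne' h5
    · exact h5.2 (hDo.interior_eq.symm ▸ hx)
  refine (h2.2 1).trans_lt ?_
  have := mul_pos hα h3
  simp only [walk]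
  linarith

/-- The stochastic representation of a solution. -/
theorem IsSolution.representation (hd : 0 < d) (hDo : IsOpen D) (hne : D.Nonempty)
    (hDb : Bornology.IsBounded D)
    (hf : ContinuousOn (fun p : ℝ × E d => f p.1 p.2) (Ici 0 ×ˢ frontier D))
    (hf₀ : ContinuousOn f₀ D) (hu : IsSolution T D f f₀ u) (h : IsNoise P U G V) {t : ℝ}
    (ht : t ∈ Icc 0 T) {x : E d} (hx : x ∈ closure D) :
    Integrable (fun ω => {p : ℝ × E d | p.2 ∈ frontier D}.indicator
      (fun p => f p.1 p.2) (walkLimit D U G V t x ω)) P ∧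
    Integrable (fun ω => {p : ℝ × E d | p.2 ∉ frontier D}.indicator
      (fun p => f₀ p.2) (walkLimit D U G V t x ω)) P ∧
    u t x = (∫ ω, {p : ℝ × E d | p.2 ∈ frontier D}.indicator
        (fun p => f p.1 p.2) (walkLimit D U G V t x ω) ∂P) +
      ∫ ω, {p : ℝ × E d | p.2 ∉ frontier D}.indicator
        (fun p => f₀ p.2) (walkLimit D U G V t x ω) ∂P := by
  obtain ⟨C, hC⟩ := hu.exists_bound hDb
  have hC0 : 0 ≤ C := (norm_nonneg _).trans (hC (0, 0))
  have hLm := h.aemeasurable_walkLimit hd hDo hDb ht.1 hx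
  have hmem := h.ae_walkLimit_mem hd hDo hDb ht.1 hx
  have hbdry := h.ae_walkLimit_mem_boundary hd hDo hne hDb ht.1 hx
  have hfr : ∀ p ∈ cylinder T D, p.2 ∈ frontier D → f p.1 p.2 = extendZero T D u p := by
    intro p hp hpf
    rw [extendZero_of_mem hp, hu.boundary _ hp.1 _ hpf]
  have hin : ∀ p ∈ cylinder T D, p.1 = 0 → p.2 ∉ frontier D → p.2 ∈ D ∧
      f₀ p.2 = extendZero T D u p := by
    intro p hp hp0 hpf
    have hpD : p.2 ∈ D := by
      by_contra hcon
      exact hpf ⟨hp.2, by rwa [hDo.interior_eq]⟩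
    rw [extendZero_of_mem hp, hp0, hu.initial _ hpD]
    exact ⟨hpD, rfl⟩
  have hcyl : ∀ᵐ ω ∂P, walkLimit D U G V t x ω ∈ cylinder T D := by
    filter_upwards [hmem] with ω hω using prod_mono_left (Icc_subset_Icc_right ht.2) hω.1
  have hm1 : Measurable ((Ici (0 : ℝ) ×ˢ frontier D).indicator fun p : ℝ × E d => f p.1 p.2) :=
    measurable_indicator_of_continuousOn (measurableSet_Ici.prod isClosed_frontier.measurableSet) hf
  have hm2 : Measurable ((univ ×ˢ D).indicator fun p : ℝ × E d => f₀ p.2) :=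
    measurable_indicator_of_continuousOn (MeasurableSet.univ.prod hDo.measurableSet)
      (hf₀.comp continuousOn_snd fun _ hp => hp.2)
  -- Measurability is available only where f and f₀ are continuous. Almost surely the limit lies
  -- where the indicators of the statement agree with those of these sets: off the frontier its time
  -- is 0 and its position is in D.
  have e1 : ∀ᵐ ω ∂P, (Ici (0 : ℝ) ×ˢ frontier D).indicator (fun p : ℝ × E d => f p.1 p.2)
      (walkLimit D U G V t x ω) = {p : ℝ × E d | p.2 ∈ frontier D}.indicator
      (fun p => f p.1 p.2) (walkLimit D U G V t x ω) := by
    filter_upwards [hcyl] with ω hω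
    by_cases hF : (walkLimit D U G V t x ω).2 ∈ frontier D
    · rw [indicator_of_mem (by exact ⟨hω.1.1, hF⟩), indicator_of_mem (by exact hF)]
    · rw [indicator_of_notMem (fun hc => hF hc.2), indicator_of_notMem (by exact hF)]
  have e2 : ∀ᵐ ω ∂P, (univ ×ˢ D).indicator (fun p : ℝ × E d => f₀ p.2)
      (walkLimit D U G V t x ω) = {p : ℝ × E d | p.2 ∉ frontier D}.indicator
      (fun p => f₀ p.2) (walkLimit D U G V t x ω) := by
    filter_upwards [hcyl, hbdry] with ω hω hb
    by_cases hF : (walkLimit D U G V t x ω).2 ∈ frontier D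
    · rw [indicator_of_notMem (fun hc => hF.2 (hDo.interior_eq.symm ▸ hc.2)),
        indicator_of_notMem (by exact fun hc => hc hF)]
    · have h0 : (walkLimit D U G V t x ω).1 = 0 := by
        rcases hb with hb | hb
        · exact hb.1
        · exact absurd hb.2 hF
      rw [indicator_of_mem (by exact ⟨mem_univ _, (hin _ hω h0 hF).1⟩), indicator_of_mem (by exact hF)]
  have esum : ∀ᵐ ω ∂P, ‖{p : ℝ × E d | p.2 ∈ frontier D}.indicator
        (fun p => f p.1 p.2) (walkLimit D U G V t x ω)‖ ≤ C ∧
      ‖{p : ℝ × E d | p.2 ∉ frontier D}.indicator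
        (fun p => f₀ p.2) (walkLimit D U G V t x ω)‖ ≤ C ∧
      extendZero T D u (walkLimit D U G V t x ω) = {p : ℝ × E d | p.2 ∈ frontier D}.indicator
        (fun p => f p.1 p.2) (walkLimit D U G V t x ω) +
      {p : ℝ × E d | p.2 ∉ frontier D}.indicator
        (fun p => f₀ p.2) (walkLimit D U G V t x ω) := by
    filter_upwards [hcyl, hbdry] with ω hω hb
    by_cases hF : (walkLimit D U G V t x ω).2 ∈ frontier D
    · rw [indicator_of_mem (by exact hF), indicator_of_notMem (by exact fun hc => hc hF),
        hfr _ hω hF]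
      exact ⟨hC _, by simpa using hC0, by simp⟩
    · have h0 : (walkLimit D U G V t x ω).1 = 0 := by
        rcases hb with hb | hb
        · exact hb.1
        · exact absurd hb.2 hF
      rw [indicator_of_notMem (by exact hF), indicator_of_mem (by exact hF),
        (hin _ hω h0 hF).2]
      exact ⟨by simpa using hC0, hC _, by simp⟩
  have i1 : Integrable (fun ω => {p : ℝ × E d | p.2 ∈ frontier D}.indicator
      (fun p => f p.1 p.2) (walkLimit D U G V t x ω)) P :=
    Integrable.of_bound ((hm1.comp_aemeasurable hLm).congr e1).aestronglyMeasurable C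
      (esum.mono fun ω hω => hω.1)
  have i2 : Integrable (fun ω => {p : ℝ × E d | p.2 ∉ frontier D}.indicator
      (fun p => f₀ p.2) (walkLimit D U G V t x ω)) P :=
    Integrable.of_bound ((hm2.comp_aemeasurable hLm).congr e2).aestronglyMeasurable C
      (esum.mono fun ω hω => hω.2.1)
  refine ⟨i1, i2, ?_⟩
  rw [← integral_add i1 i2, ← integral_congr_ae (esum.mono fun ω hω => hω.2.2)]
  have hlim : Tendsto (fun n => ∫ ω, extendZero T D u (walk D U G V t x n ω) ∂P) atTop
      (𝓝 (∫ ω, extendZero T D u (walkLimit D U G V t x ω) ∂P)) := by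
    refine tendsto_integral_of_dominated_convergence (fun _ => C)
      (fun n => (hu.measurable_extendZero.comp
        (measurable_walk h.measurable_noise D t x n)).aestronglyMeasurable) (integrable_const _)
      (fun n => Eventually.of_forall fun ω => hC _) ?_
    filter_upwards [hcyl, h.ae_walk_mem hd hDo ht.1 hx, h.ae_tendsto_walk hd hDo hDb ht.1 hx]
      with ω h1 h2 h3
    have hc : ContinuousOn (extendZero T D u) (cylinder T D) :=
      hu.continuousOn_closure.congr fun p hp => extendZero_of_mem hp
    exact (hc _ h1).tendsto.comp (tendsto_nhdsWithin_iff.2 ⟨h3, Eventually.of_forall fun n =>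
      prod_mono_left (Icc_subset_Icc_right ht.2) (h2.1 n)⟩)
  simp only [hu.integral_walk hd hDo hDb h ht hx] at hlim
  exact tendsto_nhds_unique tendsto_const_nhds hlim

end walk

/-! ### A canonical noise, and uniqueness. -/

/-- The canonical probability space of the driving noise. -/
noncomputable abbrev canonicalLaw (d : ℕ) : Measure ((ℕ → Fin (d / 2 + 1) → ℝ) ×
    ((ℕ → ℝ) × (ℕ → Metric.sphere (0 : E d) 1))) :=
  (Measure.infinitePi fun _ => volume.restrict (Icc 0 1)).prod
    ((Measure.infinitePi fun _ => gaussianReal 0 1).prod (Measure.infinitePi fun _ => sphereUniform d))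

lemma iIndepFun_of_map_eq_infinitePi {Ω α : Type*} [MeasurableSpace Ω] [MeasurableSpace α]
    {P : Measure Ω} [IsProbabilityMeasure P] {μ : Measure α} [IsProbabilityMeasure μ]
    {X : ℕ → Ω → α} (hX : ∀ n, Measurable (X n))
    (h : P.map (fun ω n => X n ω) = Measure.infinitePi fun _ => μ) :
    (∀ n, P.map (X n) = μ) ∧ iIndepFun X P := by
  have h1 : ∀ n, P.map (X n) = μ := by
    intro n
    rw [← Measure.infinitePi_map_eval (fun _ : ℕ => μ) n, ← h,
      Measure.map_map (by fun_prop) (measurable_pi_lambda _ hX)]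
    rfl
  refine ⟨h1, ?_⟩
  rw [iIndepFun_iff_map_fun_eq_infinitePi_map hX, h]
  simp only [h1]

/-- Uniqueness presupposes no probability space, so one carrying the noise must be exhibited. -/
lemma isNoise_canonical (hd : 0 < d) : IsNoise (canonicalLaw d) (fun n ω => ω.1 n)
    (fun n ω => ω.2.1 n) (fun n ω => ω.2.2 n) := by
  have := isProbabilityMeasure_sphereUniform hd
  have hU := iIndepFun_of_map_eq_infinitePi (P := canonicalLaw d) (X := fun n ω => ω.1 n)
    (μ := volume.restrict (Icc 0 1)) (fun n => by fun_prop) (Measure.fst_prod)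
  have hG : (canonicalLaw d).map (fun ω => ω.2.1) = Measure.infinitePi fun _ => gaussianReal 0 1 := by
    have : (fun ω : (ℕ → Fin (d / 2 + 1) → ℝ) × ((ℕ → ℝ) × (ℕ → Metric.sphere (0 : E d) 1)) =>
      ω.2.1) = Prod.fst ∘ Prod.snd := rfl
    rw [this, ← Measure.map_map measurable_fst measurable_snd, Measure.map_snd_prod,
      measure_univ, one_smul, Measure.map_fst_prod, measure_univ, one_smul]
  have hV : (canonicalLaw d).map (fun ω => ω.2.2) = Measure.infinitePi fun _ => sphereUniform d := by
    have : (fun ω : (ℕ → Fin (d / 2 + 1) → ℝ) × ((ℕ → ℝ) × (ℕ → Metric.sphere (0 : E d) 1)) =>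
      ω.2.2) = Prod.snd ∘ Prod.snd := rfl
    rw [this, ← Measure.map_map measurable_snd measurable_snd, Measure.map_snd_prod,
      measure_univ, one_smul, Measure.map_snd_prod, measure_univ, one_smul]
  have hG' := iIndepFun_of_map_eq_infinitePi (P := canonicalLaw d) (X := fun n ω => ω.2.1 n)
    (fun n => by fun_prop) hG
  have hV' := iIndepFun_of_map_eq_infinitePi (P := canonicalLaw d) (X := fun n ω => ω.2.2 n)
    (fun n => by fun_prop) hV
  exact
    { measurable_U := fun n => by fun_prop
      measurable_G := fun n => by fun_prop
      measurable_V := fun n => by fun_prop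
      law_U := hU.1
      law_G := hG'.1
      law_V := hV'.1
      indep_U := hU.2
      indep_G := hG'.2
      indep_V := hV'.2
      indep_U_GV := indepFun_prod measurable_id measurable_id
      indep_G_V := by
        rw [indepFun_iff_map_prod_eq_prod_map_map (by fun_prop) (by fun_prop)]
        exact (Measure.map_snd_prod.trans (by simp)).trans (congrArg₂ Measure.prod hG hV).symm }

end HeatWalk

theorem mainTheorem2 {d : ℕ} (hd : 0 < d) {D : Set (HeatWalk.E d)} (hD_open : IsOpen D)
    (hD_conn : IsConnected D) (hD_bdd : Bornology.IsBounded D) {T : ℝ} (hT : 0 < T)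
    {f : ℝ → HeatWalk.E d → ℝ} {f₀ : HeatWalk.E d → ℝ}
    (hf : ContinuousOn (fun p : ℝ × HeatWalk.E d => f p.1 p.2) (Ici 0 ×ˢ frontier D))
    (hf₀ : ContinuousOn f₀ D) (hcompat : ∀ x ∈ frontier D, f 0 x = f₀ x)
    {u : ℝ → HeatWalk.E d → ℝ} (hu : HeatWalk.IsSolution T D f f₀ u) :
    (∀ v : ℝ → HeatWalk.E d → ℝ, HeatWalk.IsSolution T D f f₀ v →
      ∀ t ∈ Icc 0 T, ∀ x ∈ closure D, v t x = u t x) ∧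
    ∀ {Ω : Type*} [MeasurableSpace Ω] (P : Measure Ω) [IsProbabilityMeasure P]
      (U : ℕ → Ω → (Fin (d / 2 + 1) → ℝ)) (G : ℕ → Ω → ℝ)
      (V : ℕ → Ω → Metric.sphere (0 : HeatWalk.E d) 1), HeatWalk.IsNoise P U G V →
      ∀ t ∈ Icc 0 T, ∀ x ∈ closure D,
        (∀ᵐ ω ∂P, Tendsto (fun n => HeatWalk.walk D U G V t x n ω) atTop
          (𝓝 (HeatWalk.walkLimit D U G V t x ω))) ∧
        (∀ᵐ ω ∂P, HeatWalk.walkLimit D U G V t x ω ∈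
          ({0} : Set ℝ) ×ˢ closure D ∪ Ioc 0 t ×ˢ frontier D) ∧
        (x ∈ D → ∀ᵐ ω ∂P, HeatWalk.walkLimit D U G V t x ω ∈
          ({0} : Set ℝ) ×ˢ closure D ∪ Ioo 0 t ×ˢ frontier D) ∧
        Integrable (fun ω => {p : ℝ × HeatWalk.E d | p.2 ∈ frontier D}.indicator
          (fun p => f p.1 p.2) (HeatWalk.walkLimit D U G V t x ω)) P ∧
        Integrable (fun ω => {p : ℝ × HeatWalk.E d | p.2 ∉ frontier D}.indicator
          (fun p => f₀ p.2) (HeatWalk.walkLimit D U G V t x ω)) P ∧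
        u t x =
          (∫ ω, {p : ℝ × HeatWalk.E d | p.2 ∈ frontier D}.indicator
            (fun p => f p.1 p.2) (HeatWalk.walkLimit D U G V t x ω) ∂P) +
          ∫ ω, {p : ℝ × HeatWalk.E d | p.2 ∉ frontier D}.indicator
            (fun p => f₀ p.2) (HeatWalk.walkLimit D U G V t x ω) ∂P := by
  have hne := hD_conn.nonempty
  refine ⟨fun v hv t ht x hx => ?_, fun P _ U G V h t ht x hx => ?_⟩
  -- On the canonical space any two solutions are given by the same expression in f, f₀ and the
  -- walk.
  · have := HeatWalk.isProbabilityMeasure_sphereUniform hd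
    have hn := HeatWalk.isNoise_canonical hd
    rw [(hv.representation hd hD_open hne hD_bdd hf hf₀ hn ht hx).2.2,
      (hu.representation hd hD_open hne hD_bdd hf hf₀ hn ht hx).2.2]
  · exact ⟨h.ae_tendsto_walk hd hD_open hD_bdd ht.1 hx,
      h.ae_walkLimit_mem_boundary hd hD_open hne hD_bdd ht.1 hx,
      fun hxD => h.ae_walkLimit_lt hd hD_open hne hD_bdd ht.1 hxD,
      hu.representation hd hD_open hne hD_bdd hf hf₀ h ht hx⟩
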